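/- **Setting.** Let $|\cdot|$ be the Euclidean norm, $D>0$, $f:\mathbb R^n\times\mathbb R^m\to\mathbb R^n$ and $\kappa:\mathbb R^n\to\mathbb R^m$. Consider $\dot X(t)=f(X(t),U(t-D))$, $t\ge 0$, with state measured only at sampling times $0=T_0<T_1<\cdots$, $T_i\to\infty$. Assume: 1. $f$ is Lipschitz on every product $\mathcal X\times\mathcal U$ of compact sets; 2. $\dot X=f(X,\omega)$ is strongly forward complete: $f(0,0)=0$ and there are a smooth $V:\mathbb R^n\to\mathbb R_{\ge0}$ and $\alpha_1,\alpha_2,\alpha_3\in\mathcal K_\infty$ with $\alpha_1(|x|)\le V(x)\le\alpha_2(|x|)$ and $\nabla V(x)\cdot f(x,\omega)\le V(x)+\alpha_3(|\omega|)$ for all $x,\omega$; 3. $\kappa\in C^1$, $\kappa(0)=0$, and the origin is globally asymptotically stable for $\dot X=f(X,\kappa(X))$; 4. $\dot X=f(X,\kappa(X)+\omega)$ is input-to-state stable with respect to $\omega$. For a state $x$ and an input history $u$ on $[-D,0)$ let $\mathcal P(x,u)=P$ be the solution of $P(\theta)=x+\int_{-D}^{\theta}f(P(\tau),u(\tau))\,d\tau$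 on $[-D,0]$, and let $\mathcal M(x,u)$ be the solution $Z$ on $[0,h)$ of $\dot Z=f(Z,\kappa(Z))$, $Z(0)=\mathcal P(x,u)(0)$. Write $U_i(\theta)=U(T_i+\theta)$, $\theta\in[-D,0)$. The input is a continuous preset history $U_0$ on $[-D,0]$, used for times before $0$, and $U(t)=\kappa(\hat Z(t))$ for $t\ge0$, where $\hat Z$ is generated in one of two ways; $K$ is a set of pairs (state, history) and $\epsilon>0$. * *Case 1.* $T_{i+1}-T_i=h$ for all $i$ and $\hat Z(T_i+s)=\hat{\mathcal M}(X(T_i),U_i)(s)$ for $s\in[0,h)$, where $\hat{\mathcal M}(x,u)$ is continuous on $[0,h)$ and $|\mathcal M(x,u)(s)-\hat{\mathcal M}(x,u)(s)|\le\epsilon$ for all $(x,u)\in K$, $s\in[0,h)$. Put $\delta(\epsilon)=\epsilon$. * *Case 2.* $T_{i+1}-T_i\le h$ for all $i$ and $\dot{\hat Z}=f(\hat Z,\kappa(\hat Z))$ on $[T_i,T_{i+1})$, $\hat Z(T_i)=\hat{\mathcal P}(X(T_i),U_i)(0)$, where $|\mathcal P(x,u)(\theta)-\hat{\mathcal P}(x,u)(\theta)|\le\epsilon$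 for all $(x,u)\in K$, $\theta\in[-D,0]$. Put $\delta(\epsilon)=\epsilon\,e^{C_f(1+C_\kappa)h}$. Here, for a given $R>0$, $C_f,C_\kappa\ge0$ are any Lipschitz constants of $f$ on $\{|x|\le R\}\times\{|u|\le R\}$ and of $\kappa$ on $\{|x|\le R\}$. **Theorem.** There is $\beta^*\in\mathcal{KL}$, depending only on $f,\kappa,D$, with $\bar\alpha(r):=\beta^*(r,0)\in\mathcal K_\infty$, such that for every $R>0$ and all such $C_f,C_\kappa$, in each of the two cases there is $\alpha^*\in\mathcal K_\infty$ (depending on $f,\kappa,D,R,C_f,C_\kappa$ and, in Case 1 only, on $h>0$) for which $$\epsilon^*(R):=\delta^{-1}\big((\alpha^*)^{-1}(R)\big)>0$$ and the following holds. Let $0<\epsilon<\epsilon^*(R)$, let the sampling times, $K$ and the approximate operator be as in the respective case, let $$r_0:=|X(0)|+\sup_{-D\le\theta\le0}|U_0(\theta)|\le\Omega(\epsilon,R):=\bar\alpha^{-1}\big(R-\alpha^*(\delta(\epsilon))\big),$$ and suppose that $K$ contains every pair $(X(T_i),U_i)$ with $|X(T_i)|+\sup_{[-D,0)}|U_i|\le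 R$ that occurs along a closed-loop solution (defined at least up to $T_i$) with these initial data. Then the closed loop has a solution for all $t\ge0$, and every such solution satisfies, for all $t\ge0$, $$|X(t)|+\sup_{t-D\le\theta\le t}|U(\theta)|\le\beta^*(r_0,t)+\alpha^*(\delta(\epsilon)).$$ That is, the closed loop is semi-globally practically stable with residual $\alpha^*(\delta(\epsilon))$. -/

import Mathlib

open Set Filter Topology MeasureTheory
open scoped ContDiff

/-- Class `K` comparison functions on `[0, ∞)`. -/
def ClassK (α : ℝ → ℝ) : Prop :=
  ContinuousOn α (Ici 0) ∧ StrictMonoOn α (Ici 0) ∧ α 0 = 0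

/-- Class `K∞` comparison functions on `[0, ∞)`. -/
def ClassKInf (α : ℝ → ℝ) : Prop :=
  ClassK α ∧ Tendsto α atTop atTop

/-- Class `KL` comparison functions on `[0, ∞) × [0, ∞)`. -/
def ClassKL (β : ℝ → ℝ → ℝ) : Prop :=
  (∀ t, 0 ≤ t → ClassK (fun s => β s t)) ∧
    ∀ s, 0 ≤ s → AntitoneOn (β s) (Ici 0) ∧ Tendsto (β s) atTop (𝓝 0)

/-- The inverse on `[0, ∞)` of a function that is a bijection of `[0, ∞)`, such as a
class `K∞` function. -/
noncomputable def invNonneg (α : ℝ → ℝ) : ℝ → ℝ :=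
  Function.invFunOn α (Ici 0)

section

variable {E F : Type*} [NormedAddCommGroup E] [NormedSpace ℝ E]
  [NormedAddCommGroup F] [NormedSpace ℝ F]

/-- `X` is a (Caratheodory) solution of `X' = g t X` on the interval `I`, with initial time
`a ∈ I`, in integral form. -/
def SolvesOn (g : ℝ → E → E) (X : ℝ → E) (a : ℝ) (I : Set ℝ) : Prop :=
  ContinuousOn X I ∧ ∀ t ∈ I,
    IntervalIntegrable (fun s => g s (X s)) volume a t ∧
      X t = X a + ∫ s in a..t, g s (X s)

/-- `C` is a Lipschitz constant of `f` on `A × B`. -/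
def LipConstOn₂ (f : E → F → E) (A : Set E) (B : Set F) (C : ℝ) : Prop :=
  ∀ x₁ ∈ A, ∀ x₂ ∈ A, ∀ u₁ ∈ B, ∀ u₂ ∈ B,
    ‖f x₁ u₁ - f x₂ u₂‖ ≤ C * (‖x₁ - x₂‖ + ‖u₁ - u₂‖)

/-- `C` is a Lipschitz constant of `κ` on `A`. -/
def LipConstOn (κ : E → F) (A : Set E) (C : ℝ) : Prop :=
  ∀ x₁ ∈ A, ∀ x₂ ∈ A, ‖κ x₁ - κ x₂‖ ≤ C * ‖x₁ - x₂‖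

/-- `f` is Lipschitz on compact sets. -/
def LipschitzOnCompacts (f : E → F → E) : Prop :=
  ∀ (A : Set E) (B : Set F), IsCompact A → IsCompact B → ∃ C > 0, LipConstOn₂ f A B C

/-- Strong forward completeness of `X' = f(X, w)`. -/
def StronglyForwardComplete (f : E → F → E) : Prop :=
  f 0 0 = 0 ∧
  ∃ (V : E → ℝ) (α₁ α₂ α₃ : ℝ → ℝ), ContDiff ℝ ∞ V ∧
    ClassKInf α₁ ∧ ClassKInf α₂ ∧ ClassKInf α₃ ∧
    (∀ x, α₁ ‖x‖ ≤ V x ∧ V x ≤ α₂ ‖x‖) ∧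
    ∀ x w, fderiv ℝ V x (f x w) ≤ V x + α₃ ‖w‖

/-- Global asymptotic stability of the origin for `X' = g(X)`: solutions exist for all
`t ≥ 0`, the origin is Lyapunov stable, and every solution converges to it. -/
def GloballyAsymptoticallyStable (g : E → E) : Prop :=
  (∀ ξ, ∃ X : ℝ → E, X 0 = ξ ∧ SolvesOn (fun _ x => g x) X 0 (Ici 0)) ∧
  (∀ e > 0, ∃ d > 0, ∀ X : ℝ → E, SolvesOn (fun _ x => g x) X 0 (Ici 0) →
    ‖X 0‖ < d → ∀ t, 0 ≤ t → ‖X t‖ < e) ∧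
  ∀ X : ℝ → E, SolvesOn (fun _ x => g x) X 0 (Ici 0) → Tendsto X atTop (𝓝 0)

/-- Input-to-state stability of `X' = g(X, w)`: for every initial state and every measurable,
locally essentially bounded input the solution exists for all `t ≥ 0` and
`|X(t)| ≤ β(|X(0)|, t) + γ(ess sup over [0, t] of |w|)`. -/
def InputToStateStable [MeasurableSpace F] (g : E → F → E) : Prop :=
  ∃ (β : ℝ → ℝ → ℝ) (γ : ℝ → ℝ), ClassKL β ∧ ClassK γ ∧
    ∀ (ξ : E) (w : ℝ → F), Measurable w →
      (∀ τ, ∃ B, ∀ᵐ s ∂(volume.restrict (Icc 0 τ)), ‖w s‖ ≤ B) →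
      (∃ X : ℝ → E, X 0 = ξ ∧ SolvesOn (fun s x => g x (w s)) X 0 (Ici 0)) ∧
      ∀ X : ℝ → E, X 0 = ξ → SolvesOn (fun s x => g x (w s)) X 0 (Ici 0) →
        ∀ t, 0 ≤ t → ∀ B, 0 ≤ B →
          (∀ᵐ s ∂(volume.restrict (Icc 0 t)), ‖w s‖ ≤ B) →
          ‖X t‖ ≤ β ‖ξ‖ t + γ B

/-- `P = 𝒫(x, u)` : the predictor trajectory on `[-D, 0]` for the state `x` and the input
history `u`. -/
def IsPredictor (f : E → F → E) (D : ℝ) (x : E) (u : ℝ → F) (P : ℝ → E) : Prop :=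
  P (-D) = x ∧ SolvesOn (fun θ p => f p (u θ)) P (-D) (Icc (-D) 0)

/-- `Z = 𝒵(p)` : the sample-horizon flow on `[0, τ)` of the delay-free closed loop,
started at `p`. -/
def IsSampleFlow (f : E → F → E) (κ : E → F) (τ : ℝ) (p : E) (Z : ℝ → E) : Prop :=
  Z 0 = p ∧ SolvesOn (fun _ z => f z (κ z)) Z 0 (Ico 0 τ)

/-- `Z = ℳ(x, u) = 𝒵(𝒫(x, u)(0))` : the sampling-horizon prediction on `[0, h)`. -/
def IsSampleHorizonPrediction (f : E → F → E) (κ : E → F) (D h : ℝ) (x : E) (u : ℝ → F)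
    (Z : ℝ → E) : Prop :=
  ∃ P : ℝ → E, IsPredictor f D x u P ∧ IsSampleFlow f κ h (P 0) Z

/-- `Mhat` approximates the sampling-horizon prediction operator within `ε`, uniformly on the
set `K` of (state, input history) pairs, with values that are continuous on `[0, h)`. -/
def ApproxPredictionOperator (f : E → F → E) (κ : E → F) (D h ε : ℝ) (K : Set (E × (ℝ → F)))
    (Mhat : E → (ℝ → F) → ℝ → E) : Prop :=
  ∀ x u, (x, u) ∈ K →
    ContinuousOn (Mhat x u) (Ico 0 h) ∧
    ∀ Z, IsSampleHorizonPrediction f κ D h x u Z → ∀ s ∈ Ico 0 h, ‖Z s - Mhat x u s‖ ≤ ε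

/-- `Phat` approximates the predictor operator within `ε`, uniformly on `K`. -/
def ApproxPredictor (f : E → F → E) (D ε : ℝ) (K : Set (E × (ℝ → F)))
    (Phat : E → (ℝ → F) → ℝ → E) : Prop :=
  ∀ x u, (x, u) ∈ K →
    ∀ P, IsPredictor f D x u P → ∀ θ ∈ Icc (-D) 0, ‖P θ - Phat x u θ‖ ≤ ε

/-- The input history at time `t`: `θ ↦ U(t + θ)` for `θ ∈ [-D, 0)`. The value `U(t)`, which at
a sampling time is only produced from this history, is not part of it; the argument outside
`[-D, 0)` carries no information. -/
noncomputable def inputHistory (D : ℝ) (U : ℝ → F) (t : ℝ) : ℝ → F :=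
  (Ico (-D) 0).indicator (fun θ => U (t + θ))

/-- Sampling times partitioning `[0, ∞)`. -/
def IsSamplingSequence (T : ℕ → ℝ) : Prop :=
  T 0 = 0 ∧ StrictMono T ∧ Tendsto T atTop atTop

/-- A prediction law: `law x u τ z` says that `z`, on `[0, τ)`, is a predicted state over a
sampling interval of length `τ`, computed from the measured state `x` and the history `u`. -/
abbrev PredictionLaw (E F : Type*) := E → (ℝ → F) → ℝ → (ℝ → E) → Prop

/-- First implementation: the predicted state is the output of `Mhat`. -/
def operatorLaw (Mhat : E → (ℝ → F) → ℝ → E) : PredictionLaw E F :=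
  fun x u τ z => ∀ s ∈ Ico 0 τ, z s = Mhat x u s

/-- Second implementation: the output of `Phat` at `0` is propagated by the closed-loop flow. -/
def predictorLaw (f : E → F → E) (κ : E → F) (Phat : E → (ℝ → F) → ℝ → E) :
    PredictionLaw E F :=
  fun x u τ z => IsSampleFlow f κ τ (Phat x u 0) z

/-- `(X, U, Zhat)` is a solution of the sampled closed loop up to the sampling time `T N`, from
the initial state `X₀` and the preset input history `U₀`. It is a solution for all `t ≥ 0` if
this holds for every `N`. -/
structure ClosedLoopUpTo (f : E → F → E) (κ : E → F) (D : ℝ) (T : ℕ → ℝ)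
    (law : PredictionLaw E F) (X₀ : E) (U₀ : ℝ → F)
    (X : ℝ → E) (U : ℝ → F) (Zhat : ℝ → E) (N : ℕ) : Prop where
  init_state : X 0 = X₀
  init_input : ∀ θ ∈ Ico (-D) 0, U θ = U₀ θ
  plant : SolvesOn (fun t x => f x (U (t - D))) X 0 (Icc 0 (T N))
  prediction : ∀ i < N,
    law (X (T i)) (inputHistory D U (T i)) (T (i + 1) - T i) (fun s => Zhat (T i + s))
  control : ∀ i < N, ∀ t ∈ Ico (T i) (T (i + 1)), U t = κ (Zhat t)

/-- `sup` of `|U(θ)|` over `θ ∈ [a, b]`. -/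
noncomputable def supNormOn (U : ℝ → F) (a b : ℝ) : ℝ :=
  sSup ((fun θ => ‖U θ‖) '' Icc a b)

/-- `ε*(R) = δ⁻¹(α⁻¹(R))`. -/
noncomputable def epsStar (α δ : ℝ → ℝ) (R : ℝ) : ℝ :=
  invNonneg δ (invNonneg α R)

/-- `Ω(ε, R) = ᾱ⁻¹(R - α(δ(ε)))` with `ᾱ(r) = β(r, 0)`. -/
noncomputable def omegaRadius (β : ℝ → ℝ → ℝ) (α δ : ℝ → ℝ) (ε R : ℝ) : ℝ :=
  invNonneg (fun r => β r 0) (R - α (δ ε))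

/-- The set `K` of approximation data contains the data visited, within the level `R`, at the
sampling times by solutions of the closed loop from `(X₀, U₀)`. -/
def CoversVisitedData (f : E → F → E) (κ : E → F) (D : ℝ) (T : ℕ → ℝ)
    (law : PredictionLaw E F) (R : ℝ) (K : Set (E × (ℝ → F))) (X₀ : E) (U₀ : ℝ → F) : Prop :=
  ∀ (X : ℝ → E) (U : ℝ → F) (Zhat : ℝ → E) (N : ℕ),
    ClosedLoopUpTo f κ D T law X₀ U₀ X U Zhat N →
    (∀ θ ∈ Ico (-D) 0, ‖X (T N)‖ + ‖U (T N + θ)‖ ≤ R) →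
    (X (T N), inputHistory D U (T N)) ∈ K

/-- The practical stability estimate for the closed loop with the given law: for all initial
data of size at most `Ω(ε, R)` the closed loop has a solution for all `t ≥ 0`, and every such
solution satisfies `|X(t)| + sup |U| ≤ β(initial norm, t) + α(δ(ε))` for all `t ≥ 0`. -/
def PracticalEstimate (f : E → F → E) (κ : E → F) (D : ℝ) (T : ℕ → ℝ)
    (law : PredictionLaw E F) (K : Set (E × (ℝ → F)))
    (β : ℝ → ℝ → ℝ) (α δ : ℝ → ℝ) (R ε : ℝ) : Prop :=
  ∀ (X₀ : E) (U₀ : ℝ → F), ContinuousOn U₀ (Icc (-D) 0) →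
    ‖X₀‖ + supNormOn U₀ (-D) 0 ≤ omegaRadius β α δ ε R →
    CoversVisitedData f κ D T law R K X₀ U₀ →
    (∃ (X : ℝ → E) (U : ℝ → F) (Zhat : ℝ → E),
      ∀ N, ClosedLoopUpTo f κ D T law X₀ U₀ X U Zhat N) ∧
    ∀ (X : ℝ → E) (U : ℝ → F) (Zhat : ℝ → E),
      (∀ N, ClosedLoopUpTo f κ D T law X₀ U₀ X U Zhat N) →
      ∀ t, 0 ≤ t →
        BddAbove ((fun θ => ‖U θ‖) '' Icc (t - D) t) ∧
        ‖X t‖ + supNormOn U (t - D) t ≤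
          β (‖X₀‖ + supNormOn U₀ (-D) 0) t + α (δ ε)

end

/-! The delay is removed by a time shift. With Y(t) = X(t + D) the plant reads Y' = f(Y, κ(Y) + w),
where w(t) = U(t) - κ(X(t + D)). Input-to-state stability then bounds Y by a transient plus γ(sup
|w|), while on the first window [0, D] strong forward completeness bounds the state by a gain σ of
the initial data. Once |w| ≤ Cκ c δ(ε) is known, `norm_add_norm_le` turns these two facts into the
claimed estimate.

The bound on w is the delicate point: the Lipschitz constants are valid only in the ball of radius R
and the approximation only on K, so the estimate is needed to prove the bound from which it follows.
Induction over the sampling times (`tracksFeedback`) breaks the circle. If w is small before T_N,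
the estimate puts the pair at T_N into K. The exact predictor for this pair is the plant trajectory
itself on [T_N, T_N + D]. The nominal flow Z from X(T_N + D) prolongs Y with w = 0, so the same
stability estimate controls it (`iss_bound`) and keeps it inside the ball with margin 3cδ. Gronwall
comparisons, needed only below a barrier that they never reach, then bound w on the next sampling
interval, by the same constant for every N.

The two implementations enter only through `AdmissibleLaw`: the first with c = 1 + Cκ exp(Cf h) and
δ = ε, the second with c = 1 and δ = ε exp(Cf (1 + Cκ) h). Hence the residual gain involves h in the
first case only.

Existence is built one sampling interval at a time: inputs before T_N determine the plant up to T_N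
+ D, which is what `ExtendedLoop` records. Each plant step is solved by truncating f, applying a
contraction argument, and showing by the reachability bound that the truncation is inactive. -/

/-! ### Solutions in integral form. -/

section SolvesOn

variable {E : Type*} [NormedAddCommGroup E] [NormedSpace ℝ E]
  {g g' : ℝ → E → E} {X X' : ℝ → E} {a b : ℝ} {I J : Set ℝ}

theorem SolvesOn.rebase (h : SolvesOn g X a I) (hb : b ∈ I) : SolvesOn g X b I := by
  refine ⟨h.1, fun t ht => ?_⟩
  obtain ⟨it, et⟩ := h.2 t ht
  obtain ⟨ib, eb⟩ := h.2 b hb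
  refine ⟨ib.symm.trans it, ?_⟩
  rw [← intervalIntegral.integral_interval_sub_left it ib, et, eb]
  abel

theorem SolvesOn.mono (h : SolvesOn g X a I) (hJ : J ⊆ I) : SolvesOn g X a J :=
  ⟨h.1.mono hJ, fun t ht => h.2 t (hJ ht)⟩

theorem SolvesOn.shift (h : SolvesOn g X a I) (c : ℝ) (hJ : ∀ t ∈ J, t + c ∈ I) :
    SolvesOn (fun t => g (t + c)) (fun t => X (t + c)) (a - c) J := by
  refine ⟨h.1.comp (by fun_prop) hJ, fun t ht => ?_⟩
  obtain ⟨it, et⟩ := h.2 _ (hJ t ht)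
  refine ⟨?_, ?_⟩
  · have := it.comp_add_right c
    simpa using this
  · rw [intervalIntegral.integral_comp_add_right (fun s => g s (X s)) c]
    simpa using et

/-- The integral sees the right-hand side only almost everywhere along the trajectory. This disposes
of interval endpoints, where an input jumps or a history is cut off. -/
theorem SolvesOn.congr (h : SolvesOn g X a I) (hI : I.OrdConnected) (ha : a ∈ I)
    (hX : EqOn X X' I) (hg : ∀ᵐ s, s ∈ I → g s (X s) = g' s (X s)) :
    SolvesOn g' X' a I := by
  refine ⟨h.1.congr hX.symm, fun t ht => ?_⟩
  obtain ⟨it, et⟩ := h.2 t ht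
  have hsub : uIoc a t ⊆ I := uIoc_subset_uIcc.trans (hI.uIcc_subset ha ht)
  have hae : ∀ᵐ s, s ∈ uIoc a t → g s (X s) = g' s (X' s) := by
    filter_upwards [hg] with s hs hsm
    rw [hs (hsub hsm), hX (hsub hsm)]
  refine ⟨it.congr_ae ((ae_restrict_iff' measurableSet_uIoc).2 hae), ?_⟩
  rw [← intervalIntegral.integral_congr_ae hae, ← hX ht, ← hX ha, et]

theorem SolvesOn.union (h : SolvesOn g X a I) (h' : SolvesOn g X b J) (hb : b ∈ I)
    (hI : IsClosed I) (hJ : IsClosed J) : SolvesOn g X a (I ∪ J) := by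
  refine ⟨h.1.union_of_isClosed h'.1 hI hJ, fun t ht => ?_⟩
  rcases ht with ht | ht
  · exact h.2 t ht
  · obtain ⟨it, et⟩ := h'.2 t ht
    obtain ⟨ib, eb⟩ := h.2 b hb
    refine ⟨ib.trans it, ?_⟩
    rw [← intervalIntegral.integral_add_adjacent_intervals ib it, et, eb]
    abel

/-- Inputs jump at sampling times, so only right derivatives can be expected. Right continuity of
the integrand gives them, and the Gronwall lemmas ask for no more. -/
theorem SolvesOn.hasDerivWithinAt [CompleteSpace E] {t c : ℝ} (h : SolvesOn g X a I)
    (htc : t < c) (hI : Icc t c ⊆ I)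
    (hc : ContinuousWithinAt (fun s => g s (X s)) (Ici t) t) :
    HasDerivWithinAt X (g t (X t)) (Ici t) t := by
  have ht : t ∈ I := hI ⟨le_rfl, htc.le⟩
  have hr := h.rebase ht
  obtain ⟨it, -⟩ := hr.2 c (hI ⟨htc.le, le_rfl⟩)
  have hm : StronglyMeasurableAtFilter (fun s => g s (X s)) (𝓝[>] t) volume :=
    ⟨Ioc t c, Ioc_mem_nhdsGT htc, it.1.aestronglyMeasurable⟩
  have hd := intervalIntegral.integral_hasDerivWithinAt_right (a := t) (b := t)
    (f := fun s => g s (X s)) (s := Ici t) (t := Ioi t)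
    (by simp) hm (hc.mono Ioi_subset_Ici_self)
  have h2 := hd.const_add (X t)
  refine h2.congr_of_eventuallyEq ?_ (by simp)
  filter_upwards [Icc_mem_nhdsGE htc] with s hs
  exact (hr.2 s (hI hs)).2

theorem SolvesOn.hasDerivWithinAt_of_continuousOn [CompleteSpace E] {c : ℝ} (h : SolvesOn g X c I)
    (hI : Ico a b ⊆ I) (hc : ContinuousOn (fun s => g s (X s)) (Ico a b)) :
    ∀ t ∈ Ico a b, HasDerivWithinAt X (g t (X t)) (Ici t) t := by
  intro t ht
  obtain ⟨c, htc, hcb⟩ := exists_between ht.2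
  refine h.hasDerivWithinAt htc (fun s hs => hI ⟨ht.1.trans hs.1, hs.2.trans_lt hcb⟩) ?_
  refine (hc t ht).mono_of_mem_nhdsWithin ?_
  filter_upwards [Ico_mem_nhdsGE ht.2] with s hs using ⟨ht.1.trans hs.1, hs.2⟩

end SolvesOn

/-! ### Measurability of inputs, barriers and Gronwall bounds. -/

theorem ContinuousOn.measurable_indicator {F : Type*} [TopologicalSpace F] [Zero F]
    [MeasurableSpace F] [BorelSpace F] {v : ℝ → F} {s : Set ℝ} (hv : ContinuousOn v s)
    (hs : MeasurableSet s) : Measurable (s.indicator v) := by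
  classical
  have : Measurable (s.piecewise v 0) := hv.measurable_piecewise continuousOn_const hs
  rwa [piecewise_eq_indicator] at this

/-- A barrier principle for continuous functions. -/
theorem lt_of_forall_lt_imp_lt {φ : ℝ → ℝ} {a b r : ℝ} (hφ : ContinuousOn φ (Icc a b))
    (h : ∀ t ∈ Icc a b, (∀ s ∈ Ico a t, φ s < r) → φ t < r) : ∀ t ∈ Icc a b, φ t < r := by
  by_contra! hcon
  obtain ⟨t, ht, hrt⟩ := hcon
  have hcl : IsClosed (Icc a b ∩ φ ⁻¹' Ici r) :=
    hφ.preimage_isClosed_of_isClosed isClosed_Icc isClosed_Ici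
  have hcomp : IsCompact (Icc a b ∩ φ ⁻¹' Ici r) :=
    isCompact_Icc.of_isClosed_subset hcl inter_subset_left
  -- m is the first time at which the level r is reached. If m = a the premise is vacuous, so the
  -- hypothesis also contains the initial condition.
  obtain ⟨m, ⟨hm, hmr⟩, hmin⟩ := hcomp.exists_isLeast ⟨t, ht, hrt⟩
  refine absurd (h m hm fun s hs => ?_) (not_lt.2 hmr)
  by_contra! hrs
  exact absurd (hmin ⟨⟨hs.1, hs.2.le.trans hm.2⟩, hrs⟩) (not_le.2 hs.2)

/-- A Gronwall estimate whose differential inequality is only needed below a barrier that the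
estimate itself does not reach. -/
theorem norm_sub_le_gronwallBound_of_barrier {E : Type*} [NormedAddCommGroup E] [NormedSpace ℝ E]
    {y z y' z' : ℝ → E} {a b d K e q : ℝ} (hy : ContinuousOn y (Icc a b))
    (hz : ContinuousOn z (Icc a b)) (hy' : ∀ t ∈ Ico a b, HasDerivWithinAt y (y' t) (Ici t) t)
    (hz' : ∀ t ∈ Ico a b, HasDerivWithinAt z (z' t) (Ici t) t) (ha : ‖y a - z a‖ ≤ d)
    (bound : ∀ t ∈ Ico a b, ‖y t - z t‖ < q → ‖y' t - z' t‖ ≤ K * ‖y t - z t‖ + e)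
    (hq : ∀ t ∈ Icc a b, gronwallBound d K e (t - a) < q) :
    ∀ t ∈ Icc a b, ‖y t - z t‖ ≤ gronwallBound d K e (t - a) := by
  have main : ∀ t ∈ Icc a b, (∀ s ∈ Ico a t, ‖y s - z s‖ < q) →
      ‖y t - z t‖ ≤ gronwallBound d K e (t - a) := by
    intro t ht hlt
    have hsub : Icc a t ⊆ Icc a b := Icc_subset_Icc_right ht.2
    have hsub' : Ico a t ⊆ Ico a b := Ico_subset_Ico_right ht.2
    exact norm_le_gronwallBound_of_norm_deriv_right_le
      (f := fun s => y s - z s) (f' := fun s => y' s - z' s) ((hy.mono hsub).sub (hz.mono hsub))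
      (fun s hs => (hy' s (hsub' hs)).sub (hz' s (hsub' hs))) ha
      (fun s hs => bound s (hsub' hs) (hlt s hs)) t ⟨ht.1, le_rfl⟩
  have hlt := lt_of_forall_lt_imp_lt (r := q) (hy.sub hz).norm
    fun t ht h => (main t ht h).trans_lt (hq t ht)
  exact fun t ht => main t ht fun s hs => hlt s ⟨hs.1, hs.2.le.trans ht.2⟩

/-- Writing the forcing as K * e cancels the 1/K of the Gronwall formula, so that K = 0 needs no
separate bound later. -/
theorem gronwallBound_zero_mul_le {K e x : ℝ} (he : 0 ≤ e) :
    gronwallBound 0 K (K * e) x ≤ e * Real.exp (K * x) := by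
  by_cases hK : K = 0
  · subst hK; simp [gronwallBound_K0, he]
  · rw [gronwallBound_of_K_ne_0 hK]
    field_simp
    nlinarith

theorem gronwallBound_one_le {d e x : ℝ} (he : 0 ≤ e) :
    gronwallBound d 1 e x ≤ (d + e) * Real.exp x := by
  rw [gronwallBound_of_K_ne_0 one_ne_zero]
  simp only [one_mul, div_one]
  nlinarith

/-! ### Comparison functions and their inverses. -/

/-- Nondecreasing continuous functions on `[0, ∞)` that vanish at `0`. -/
structure MonoGain (g : ℝ → ℝ) : Prop where
  continuousOn : ContinuousOn g (Ici 0)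
  monotoneOn : MonotoneOn g (Ici 0)
  map_zero : g 0 = 0

theorem ClassK.monoGain {g : ℝ → ℝ} (h : ClassK g) : MonoGain g :=
  ⟨h.1, h.2.1.monotoneOn, h.2.2⟩

namespace MonoGain

variable {g g' : ℝ → ℝ}

theorem nonneg (h : MonoGain g) {r : ℝ} (hr : 0 ≤ r) : 0 ≤ g r := by
  have := h.monotoneOn self_mem_Ici hr hr
  rwa [h.map_zero] at this

theorem mono (h : MonoGain g) {r s : ℝ} (hr : 0 ≤ r) (hrs : r ≤ s) : g r ≤ g s :=
  h.monotoneOn hr (hr.trans hrs) hrs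

theorem mapsTo (h : MonoGain g) : MapsTo g (Ici 0) (Ici 0) := fun _ hr => h.nonneg hr

theorem comp (h : MonoGain g) (h' : MonoGain g') : MonoGain (fun r => g (g' r)) where
  continuousOn := h.continuousOn.comp h'.continuousOn h'.mapsTo
  monotoneOn := h.monotoneOn.comp h'.monotoneOn h'.mapsTo
  map_zero := by simp [h'.map_zero, h.map_zero]

theorem add (h : MonoGain g) (h' : MonoGain g') : MonoGain (fun r => g r + g' r) where
  continuousOn := h.continuousOn.add h'.continuousOn
  monotoneOn := h.monotoneOn.add h'.monotoneOn
  map_zero := by simp [h'.map_zero, h.map_zero]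

theorem const_mul (h : MonoGain g) {c : ℝ} (hc : 0 ≤ c) : MonoGain (fun r => c * g r) where
  continuousOn := h.continuousOn.const_smul c
  monotoneOn := fun _ hr _ hs hrs => mul_le_mul_of_nonneg_left (h.monotoneOn hr hs hrs) hc
  map_zero := by simp [h.map_zero]

theorem id : MonoGain (fun r => r) := ⟨continuousOn_id, fun _ _ _ _ h => h, rfl⟩

theorem linear {c : ℝ} (hc : 0 ≤ c) : MonoGain (fun r => c * r) := id.const_mul hc

/-- The sum is at most twice the larger term. This separates transient from residual inside a gain
and is the source of the factors 2 in `transientGain` and `residualGain`. -/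
theorem map_add_le (h : MonoGain g) {r s : ℝ} (hr : 0 ≤ r) (hs : 0 ≤ s) :
    g (r + s) ≤ g (2 * r) + g (2 * s) := by
  rcases le_total r s with hrs | hrs
  · have h1 := h.mono (by positivity) (show r + s ≤ 2 * s by linarith)
    have h2 := h.nonneg (show 0 ≤ 2 * r by positivity)
    linarith
  · have h1 := h.mono (by positivity) (show r + s ≤ 2 * r by linarith)
    have h2 := h.nonneg (show 0 ≤ 2 * s by positivity)
    linarith

/-- A `MonoGain` may be bounded or locally constant; a linear term of positive slope repairs both
defects. Both closed-loop gains contain such a term. -/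
theorem classKInf_add_linear (h : MonoGain g) {c : ℝ} (hc : 0 < c) :
    ClassKInf (fun r => g r + c * r) := by
  refine ⟨⟨h.continuousOn.add (by fun_prop), fun r hr s hs hrs => ?_, by simp [h.map_zero]⟩, ?_⟩
  · have := h.monotoneOn hr hs hrs.le
    have := mul_lt_mul_of_pos_left hrs hc
    simp only
    linarith
  · refine tendsto_atTop_mono' _ ?_ (tendsto_id.const_mul_atTop hc)
    filter_upwards [eventually_ge_atTop 0] with r hr
    have := h.nonneg hr
    simp only [_root_.id]
    linarith

end MonoGain

namespace ClassKInf

variable {α : ℝ → ℝ}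

/-- The order automorphism of `ℝ` that extends a class `K∞` function by the identity. -/
noncomputable def orderIso (h : ClassKInf α) : ℝ ≃o ℝ :=
  StrictMono.orderIsoOfSurjective (fun x => if 0 ≤ x then α x else x)
    (by
      intro x y hxy
      have hn : ∀ z, 0 ≤ z → 0 ≤ α z := fun z hz => h.1.monoGain.nonneg hz
      by_cases hx : 0 ≤ x
      · have hy : 0 ≤ y := hx.trans hxy.le
        simpa [hx, hy] using h.1.2.1 hx hy hxy
      · by_cases hy : 0 ≤ y
        · simpa [hx, hy] using (not_le.1 hx).trans_le (hn y hy)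
        · simpa [hx, hy] using hxy)
    (by
      intro y
      by_cases hy : 0 ≤ y
      · obtain ⟨b, hb0, hb⟩ := ((h.2.eventually_ge_atTop y).and (eventually_ge_atTop 0)).exists
        have := intermediate_value_Icc hb (h.1.1.mono Icc_subset_Ici_self)
        obtain ⟨x, hx, hxy⟩ := this ⟨by rw [h.1.2.2]; exact hy, hb0⟩
        exact ⟨x, by simp [hx.1, hxy]⟩
      · exact ⟨y, by simp [hy]⟩)

theorem orderIso_apply (h : ClassKInf α) {x : ℝ} (hx : 0 ≤ x) : h.orderIso x = α x :=
  if_pos hx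

theorem orderIso_symm_nonneg (h : ClassKInf α) {y : ℝ} (hy : 0 ≤ y) : 0 ≤ h.orderIso.symm y := by
  rw [OrderIso.le_symm_apply, h.orderIso_apply le_rfl, h.1.2.2]
  exact hy

theorem apply_orderIso_symm (h : ClassKInf α) {y : ℝ} (hy : 0 ≤ y) :
    α (h.orderIso.symm y) = y := by
  rw [← h.orderIso_apply (h.orderIso_symm_nonneg hy), OrderIso.apply_symm_apply]

theorem monoGain_symm (h : ClassKInf α) : MonoGain h.orderIso.symm where
  continuousOn := h.orderIso.symm.continuous.continuousOn
  monotoneOn := h.orderIso.symm.monotone.monotoneOn _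
  map_zero := by
    rw [OrderIso.symm_apply_eq, h.orderIso_apply le_rfl, h.1.2.2]

theorem invNonneg_spec (h : ClassKInf α) {y : ℝ} (hy : 0 ≤ y) :
    0 ≤ invNonneg α y ∧ α (invNonneg α y) = y :=
  have hex : ∃ x ∈ Ici (0 : ℝ), α x = y := ⟨_, h.orderIso_symm_nonneg hy, h.apply_orderIso_symm hy⟩
  ⟨Function.invFunOn_mem hex, Function.invFunOn_eq hex⟩

theorem invNonneg_pos (h : ClassKInf α) {y : ℝ} (hy : 0 < y) : 0 < invNonneg α y := by
  obtain ⟨h1, h2⟩ := h.invNonneg_spec hy.le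
  refine lt_of_le_of_ne h1 fun h0 => ?_
  rw [← h0, h.1.2.2] at h2
  exact hy.ne h2

theorem lt_iff (h : ClassKInf α) {x y : ℝ} (hx : 0 ≤ x) (hy : 0 ≤ y) : α x < α y ↔ x < y :=
  h.1.2.1.lt_iff_lt hx hy

end ClassKInf

theorem epsStar_pos {α δ : ℝ → ℝ} {R : ℝ} (hα : ClassKInf α) (hδ : ClassKInf δ) (hR : 0 < R) :
    0 < epsStar α δ R :=
  hδ.invNonneg_pos (hα.invNonneg_pos hR)

theorem apply_lt_of_lt_epsStar {α δ : ℝ → ℝ} {R ε : ℝ} (hα : ClassKInf α) (hδ : ClassKInf δ)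
    (hR : 0 < R) (hε : 0 ≤ ε) (h : ε < epsStar α δ R) : α (δ ε) < R := by
  have h1 := hα.invNonneg_spec hR.le
  have h2 := hδ.invNonneg_spec h1.1
  have h3 := (hδ.lt_iff hε h2.1).2 h
  rw [h2.2] at h3
  have h4 := (hα.lt_iff (hδ.1.monoGain.nonneg hε) h1.1).2 h3
  rwa [h1.2] at h4

/-- The radius Ω is designed for this: the transient at time 0, which is its largest value, and the
residual together fit below R. -/
theorem add_le_of_le_omegaRadius {β : ℝ → ℝ → ℝ} {α δ : ℝ → ℝ} {R ε r : ℝ}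
    (hβ : ClassKInf (fun r => β r 0)) (hR : α (δ ε) < R) (hr : 0 ≤ r)
    (h : r ≤ omegaRadius β α δ ε R) : β r 0 + α (δ ε) ≤ R := by
  have h1 := hβ.invNonneg_spec (sub_pos.2 hR).le
  have h2 := hβ.1.monoGain.mono hr h
  have h3 : β (omegaRadius β α δ ε R) 0 = R - α (δ ε) := h1.2
  simp only [h3] at h2
  linarith

/-- A continuous map that vanishes at `0` has a nondecreasing continuous gain. -/
theorem exists_monoGain_norm_le {E F : Type*} [NormedAddCommGroup E] [NormedSpace ℝ E]
    [ProperSpace E] [NormedAddCommGroup F] {κ : E → F} (hκ : Continuous κ) (h0 : κ 0 = 0) :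
    ∃ ρ : ℝ → ℝ, MonoGain ρ ∧ ∀ x, ‖κ x‖ ≤ ρ ‖x‖ := by
  have hK : IsCompact (Metric.closedBall (0 : E) 1) := isCompact_closedBall 0 1
  have hne : (Metric.closedBall (0 : E) 1).Nonempty := ⟨0, by simp⟩
  have hb : ∀ r : ℝ, BddAbove ((fun y : E => ‖κ (r • y)‖) '' Metric.closedBall (0 : E) 1) :=
    fun r => (hK.image (by fun_prop)).bddAbove
  have key : ∀ r s : ℝ, 0 ≤ r → r ≤ s → ∀ y ∈ Metric.closedBall (0 : E) 1,
      ‖κ (r • y)‖ ≤ sSup ((fun y : E => ‖κ (s • y)‖) '' Metric.closedBall (0 : E) 1) := by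
    intro r s hr hrs y hy
    rcases hr.eq_or_lt with rfl | hr'
    · exact le_csSup (hb s) ⟨0, by simp, by simp⟩
    · have hs : 0 < s := hr'.trans_le hrs
      refine le_csSup (hb s) ⟨(r / s) • y, ?_, ?_⟩
      · rw [mem_closedBall_zero_iff] at hy ⊢
        rw [norm_smul, Real.norm_of_nonneg (by positivity)]
        exact mul_le_one₀ ((div_le_one hs).2 hrs) (norm_nonneg _) hy
      · simp only [smul_smul]
        rw [mul_div_cancel₀ _ hs.ne']
  -- Rescaling to the unit ball keeps the compact set fixed while r varies, so that continuity in r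
  -- follows from continuity of a supremum over a compact set.
  refine ⟨fun r => sSup ((fun y : E => ‖κ (r • y)‖) '' Metric.closedBall (0 : E) 1),
    ⟨?_, ?_, ?_⟩, ?_⟩
  · exact (hK.continuous_sSup (f := fun (r : ℝ) (y : E) => ‖κ (r • y)‖)
      (by simp only [Function.HasUncurry.uncurry, _root_.id]; fun_prop)).continuousOn
  · intro r hr s _ hrs
    refine csSup_le (hne.image _) ?_
    rintro _ ⟨y, hy, rfl⟩
    exact key r s hr hrs y hy
  · simp only [zero_smul, h0, norm_zero]
    rw [hne.image_const, csSup_singleton]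
  · intro x
    rcases eq_or_ne x 0 with rfl | hx
    · rw [h0, norm_zero, norm_zero]
      simp only [zero_smul, h0, norm_zero]
      rw [hne.image_const, csSup_singleton]
    · have := key ‖x‖ ‖x‖ (norm_nonneg x) le_rfl (‖x‖⁻¹ • x) (by
        rw [mem_closedBall_zero_iff, norm_smul, norm_inv, norm_norm,
          inv_mul_cancel₀ (norm_ne_zero_iff.2 hx)])
      rwa [smul_smul, mul_inv_cancel₀ (norm_ne_zero_iff.2 hx), one_smul] at this

/-! ### Existence for the plant by truncation. -/

/-- Global existence for globally Lipschitz, bounded Caratheodory right-hand sides. -/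
theorem exists_solvesOn_of_lipschitz {E : Type*} [NormedAddCommGroup E] [NormedSpace ℝ E]
    [ProperSpace E] [MeasurableSpace E] [BorelSpace E] {g : ℝ → E → E} {C M : ℝ}
    (hC : 0 < C) (hgm : Measurable (Function.uncurry g))
    (hlip : ∀ s x y, ‖g s x - g s y‖ ≤ C * ‖x - y‖) (hM : ∀ s x, ‖g s x‖ ≤ M)
    {a b : ℝ} (hab : a ≤ b) (ξ : E) :
    ∃ X : ℝ → E, X a = ξ ∧ SolvesOn g X a (Icc a b) := by
  classical
  -- The fixed point is sought as Y(s) = exp(-lam (s - a)) X(s). In this weighted norm the Picard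
  -- map contracts by C / lam = 1/2 on the whole interval, so no gluing of short time steps is
  -- needed.
  set lam : ℝ := 2 * C
  have hlam : 0 < lam := by positivity
  have hint : ∀ {X : ℝ → E}, Continuous X → ∀ s t,
      IntervalIntegrable (fun s => g s (X s)) volume s t := fun {X} hX s t => by
    refine (intervalIntegrable_const (c := M)).mono_fun' ?_ (Eventually.of_forall fun s => hM _ _)
    exact (hgm.comp (measurable_id.prodMk hX.measurable)).aestronglyMeasurable
  let w : C(Icc a b, E) → ℝ → E := fun Y s => Real.exp (lam * (s - a)) • IccExtend hab Y s
  have hw : ∀ Y, Continuous (w Y) := fun Y => by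
    have : Continuous (IccExtend hab Y) := Y.continuous.Icc_extend'
    fun_prop
  let Φ : C(Icc a b, E) → C(Icc a b, E) := fun Y =>
    ⟨fun t => Real.exp (-(lam * ((t : ℝ) - a))) • (ξ + ∫ s in a..t, g s (w Y s)), by
      have h1 : Continuous fun t : ℝ => ∫ s in a..t, g s (w Y s) :=
        intervalIntegral.continuous_primitive (hint (hw Y)) a
      have h2 := h1.comp (continuous_subtype_val (p := fun t => t ∈ Icc a b))
      refine Continuous.smul (by fun_prop) (continuous_const.add h2)⟩
  have hΦ : ContractingWith (1 / 2) Φ := by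
    refine ⟨by rw [div_lt_one] <;> norm_num, LipschitzWith.of_dist_le_mul fun Y Y' => ?_⟩
    rw [ContinuousMap.dist_le (by positivity)]
    intro t
    have hd : ∀ s ∈ Ioc a (t : ℝ), ‖g s (w Y s) - g s (w Y' s)‖ ≤
        C * dist Y Y' * Real.exp (lam * (s - a)) := by
      intro s hs
      refine (hlip _ _ _).trans ?_
      simp only [w]
      rw [← smul_sub, norm_smul, Real.norm_of_nonneg (Real.exp_pos _).le, ← dist_eq_norm]
      have : dist (IccExtend hab Y s) (IccExtend hab Y' s) ≤ dist Y Y' :=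
        ContinuousMap.dist_apply_le_dist _
      have he := Real.exp_pos (lam * (s - a))
      nlinarith [mul_le_mul_of_nonneg_left this (mul_pos hC he).le]
    have hI : ‖∫ s in a..t, (g s (w Y s) - g s (w Y' s))‖ ≤
        ∫ s in a..(t : ℝ), C * dist Y Y' * Real.exp (lam * (s - a)) :=
      intervalIntegral.norm_integral_le_of_norm_le t.2.1
        (Eventually.of_forall hd) (Continuous.intervalIntegrable (by fun_prop) _ _)
    have hE : ∫ s in a..(t : ℝ), C * dist Y Y' * Real.exp (lam * (s - a)) =
        C * dist Y Y' * (lam⁻¹ * (Real.exp (lam * (t - a)) - 1)) := by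
      rw [intervalIntegral.integral_const_mul]
      congr 1
      have : ∀ s ∈ uIcc a (t : ℝ), HasDerivAt (fun s => lam⁻¹ * Real.exp (lam * (s - a)))
          (Real.exp (lam * (s - a))) s := by
        intro s _
        have h1 : HasDerivAt (fun s : ℝ => lam * (s - a)) lam s := by
          simpa using ((hasDerivAt_id s).sub_const a).const_mul lam
        have := (h1.exp).const_mul lam⁻¹
        rwa [mul_comm (Real.exp _) lam, inv_mul_cancel_left₀ hlam.ne'] at this
      rw [intervalIntegral.integral_eq_sub_of_hasDerivAt this
        (Continuous.intervalIntegrable (by fun_prop) _ _)]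
      simp
      ring
    rw [dist_eq_norm]
    have hsub : Φ Y t - Φ Y' t = Real.exp (-(lam * ((t : ℝ) - a))) •
        ∫ s in a..t, (g s (w Y s) - g s (w Y' s)) := by
      rw [intervalIntegral.integral_sub (hint (hw Y) _ _) (hint (hw Y') _ _)]
      simp only [Φ, ContinuousMap.coe_mk, ← smul_sub]
      congr 1
      abel
    rw [hsub, norm_smul, Real.norm_of_nonneg (Real.exp_pos _).le]
    rw [hE] at hI
    have he := Real.exp_pos (-(lam * ((t : ℝ) - a)))
    have hee : Real.exp (-(lam * ((t : ℝ) - a))) * Real.exp (lam * (t - a)) = 1 := by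
      rw [← Real.exp_add]; simp
    calc _ ≤ Real.exp (-(lam * ((t : ℝ) - a))) *
          (C * dist Y Y' * (lam⁻¹ * (Real.exp (lam * (t - a)) - 1))) :=
        mul_le_mul_of_nonneg_left hI he.le
      _ = C * lam⁻¹ * dist Y Y' * (1 - Real.exp (-(lam * ((t : ℝ) - a)))) := by
        linear_combination C * lam⁻¹ * dist Y Y' * hee
      _ ≤ C * lam⁻¹ * dist Y Y' * 1 := by
        apply mul_le_mul_of_nonneg_left (by linarith)
        positivity
      _ = _ := by
        simp only [lam]
        push_cast
        field_simp
  set Y := ContractingWith.fixedPoint Φ hΦ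
  have hY : Φ Y = Y := hΦ.fixedPoint_isFixedPt
  have hval : ∀ t ∈ Icc a b, w Y t = ξ + ∫ s in a..t, g s (w Y s) := by
    intro t ht
    have h1 : Φ Y ⟨t, ht⟩ = Y ⟨t, ht⟩ := by rw [hY]
    simp only [Φ, ContinuousMap.coe_mk] at h1
    have : w Y t = Real.exp (lam * (t - a)) • Y ⟨t, ht⟩ := by
      simp only [w]; rw [IccExtend_of_mem]
    rw [this, ← h1, smul_smul, ← Real.exp_add]
    simp
  have h0 : w Y a = ξ := by simpa using hval a ⟨le_rfl, hab⟩
  exact ⟨w Y, h0, (hw Y).continuousOn, fun t ht => ⟨hint (hw Y) _ _, by rw [h0]; exact hval t ht⟩⟩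

/-- The radial retraction onto the closed ball of radius `r`. -/
noncomputable def radialRetraction {E : Type*} [NormedAddCommGroup E] [NormedSpace ℝ E]
    (r : ℝ) (x : E) : E := (r / max r ‖x‖) • x

section radialRetraction

variable {E : Type*} [NormedAddCommGroup E] [NormedSpace ℝ E] {r : ℝ}

theorem norm_radialRetraction_le (hr : 0 < r) (x : E) : ‖radialRetraction r x‖ ≤ r := by
  have hm : 0 < max r ‖x‖ := lt_max_of_lt_left hr
  rw [radialRetraction, norm_smul, Real.norm_of_nonneg (by positivity), div_mul_eq_mul_div,
    div_le_iff₀ hm]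
  exact mul_le_mul_of_nonneg_left (le_max_right _ _) hr.le

theorem radialRetraction_of_norm_le (hr : 0 < r) {x : E} (hx : ‖x‖ ≤ r) :
    radialRetraction r x = x := by
  rw [radialRetraction, max_eq_left hx, div_self hr.ne', one_smul]

theorem norm_radialRetraction_sub_le (hr : 0 < r) (x y : E) :
    ‖radialRetraction r x - radialRetraction r y‖ ≤ 2 * ‖x - y‖ := by
  have hp : 0 < max r ‖x‖ := lt_max_of_lt_left hr
  have hq : 0 < max r ‖y‖ := lt_max_of_lt_left hr
  have hpq : |max r ‖x‖ - max r ‖y‖| ≤ ‖x - y‖ := by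
    rw [max_comm r, max_comm r]
    exact (abs_max_sub_max_le_abs _ _ _).trans (abs_norm_sub_norm_le x y)
  have hrp : r / max r ‖x‖ ≤ 1 := (div_le_one hp).2 (le_max_left _ _)
  have hyq : ‖y‖ / max r ‖y‖ ≤ 1 := (div_le_one hq).2 (le_max_right _ _)
  rw [radialRetraction, radialRetraction]
  generalize max r ‖x‖ = p at *
  generalize max r ‖y‖ = q at *
  -- The difference splits into a contraction of x - y and a multiple of y caused by the different
  -- scalings; each is at most ‖x - y‖, whence the constant 2.
  have key : (r / p) • x - (r / q) • y =
      (r / p) • (x - y) + ((r / p) * ((q - p) / q)) • y := by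
    rw [smul_sub, sub_add, ← sub_smul]
    congr 2
    field_simp
    ring
  rw [key]
  have h1 : ‖(r / p) • (x - y)‖ ≤ ‖x - y‖ := by
    rw [norm_smul, Real.norm_of_nonneg (by positivity)]
    exact mul_le_of_le_one_left (norm_nonneg _) hrp
  have h2 : ‖((r / p) * ((q - p) / q)) • y‖ ≤ ‖x - y‖ := by
    rw [norm_smul, norm_mul, Real.norm_of_nonneg (by positivity), norm_div, Real.norm_eq_abs,
      Real.norm_of_nonneg hq.le, abs_sub_comm]
    calc _ = (r / p) * (|p - q| * (‖y‖ / q)) := by ring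
      _ ≤ 1 * (‖x - y‖ * 1) := by gcongr
      _ = _ := by ring
  linarith [norm_add_le ((r / p) • (x - y)) (((r / p) * ((q - p) / q)) • y)]

end radialRetraction

theorem LipschitzOnCompacts.continuous {E F : Type*} [NormedAddCommGroup E] [ProperSpace E]
    [NormedAddCommGroup F] [ProperSpace F] {f : E → F → E}
    (hf : LipschitzOnCompacts f) : Continuous (Function.uncurry f) := by
  rw [continuous_iff_continuousAt]
  rintro ⟨x₀, u₀⟩
  obtain ⟨C, hC, hlip⟩ := hf _ _ (isCompact_closedBall x₀ 1) (isCompact_closedBall u₀ 1)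
  rw [ContinuousAt, tendsto_iff_norm_sub_tendsto_zero]
  have hlim : Tendsto (fun p : E × F => C * (‖p.1 - x₀‖ + ‖p.2 - u₀‖)) (𝓝 (x₀, u₀)) (𝓝 0) := by
    have : Continuous fun p : E × F => C * (‖p.1 - x₀‖ + ‖p.2 - u₀‖) := by fun_prop
    simpa using this.tendsto (x₀, u₀)
  refine squeeze_zero' (Eventually.of_forall fun _ => norm_nonneg _) ?_ hlim
  filter_upwards [prod_mem_nhds (Metric.closedBall_mem_nhds x₀ one_pos)
    (Metric.closedBall_mem_nhds u₀ one_pos)] with p hp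
  exact hlip _ hp.1 _ (Metric.mem_closedBall_self zero_le_one) _ hp.2 _
    (Metric.mem_closedBall_self zero_le_one)

section Plant

variable {E F : Type*} [NormedAddCommGroup E] [NormedSpace ℝ E] [NormedAddCommGroup F]
  {f : E → F → E}

/-- Strong forward completeness bounds the states reached within a given time. -/
theorem StronglyForwardComplete.exists_reach_gain (hfc : StronglyForwardComplete f) (τ : ℝ) :
    ∃ σ : ℝ → ℝ, MonoGain σ ∧ ∀ (a b r : ℝ) (v : ℝ → F) (Y : ℝ → E), b - a ≤ τ →
      ContinuousOn Y (Icc a b) →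
      (∀ t ∈ Ico a b, HasDerivWithinAt Y (f (Y t) (v t)) (Ici t) t) →
      ‖Y a‖ ≤ r → (∀ t ∈ Ico a b, ‖v t‖ ≤ r) → ∀ t ∈ Icc a b, ‖Y t‖ ≤ σ r := by
  obtain ⟨-, V, α₁, α₂, α₃, hV, h₁, h₂, h₃, hVb, hVd⟩ := hfc
  -- Along a trajectory V' ≤ V + α₃(r) and initially V ≤ α₂(r), so V ≤ exp(τ) (α₂(r) + α₃(r));
  -- applying the inverse of α₁ returns to the norm.
  refine ⟨fun r => h₁.orderIso.symm (Real.exp τ * (α₂ r + α₃ r)),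
    h₁.monoGain_symm.comp ((h₂.1.monoGain.add h₃.1.monoGain).const_mul (Real.exp_pos τ).le), ?_⟩
  intro a b r v Y hτ hY hd hYa hv t ht
  have hr : 0 ≤ r := (norm_nonneg _).trans hYa
  have hα₃ := h₃.1.monoGain.nonneg hr
  have hα₂ := h₂.1.monoGain.nonneg hr
  have hcomp : ∀ s ∈ Ico a b, HasDerivWithinAt (fun s => V (Y s))
      (fderiv ℝ V (Y s) (f (Y s) (v s))) (Ici s) s := fun s hs =>
    ((hV.differentiable (by simp)).differentiableAt.hasFDerivAt (x := Y s)).comp_hasDerivWithinAt s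
      (hd s hs)
  have hG := le_gronwallBound_of_liminf_deriv_right_le (f := fun s => V (Y s))
    (f' := fun s => fderiv ℝ V (Y s) (f (Y s) (v s))) (δ := α₂ r) (K := 1) (ε := α₃ r)
    (a := a) (b := b) (hV.continuous.comp_continuousOn hY)
    (fun s hs q hq => (hcomp s hs).liminf_right_slope_le hq)
    ((hVb _).2.trans (h₂.1.monoGain.mono (norm_nonneg _) hYa))
    (fun s hs => by
      have := hVd (Y s) (v s)
      have := h₃.1.monoGain.mono (norm_nonneg _) (hv s hs)
      linarith) t ht
  have hlow := (hVb (Y t)).1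
  have hexp : Real.exp (t - a) ≤ Real.exp τ := Real.exp_le_exp.2 (by linarith [ht.2])
  have hle : α₁ ‖Y t‖ ≤ Real.exp τ * (α₂ r + α₃ r) := by
    refine hlow.trans (hG.trans ((gronwallBound_one_le hα₃).trans ?_))
    rw [mul_comm]
    gcongr
  rw [OrderIso.le_symm_apply, h₁.orderIso_apply (norm_nonneg _)]
  exact hle

/-- Existence of solutions of a strongly forward complete system on a bounded interval. -/
theorem exists_solvesOn_plant [ProperSpace E] [MeasurableSpace E] [BorelSpace E] [ProperSpace F]
    [MeasurableSpace F] [BorelSpace F] (hf : LipschitzOnCompacts f)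
    (hfc : StronglyForwardComplete f) {a b M : ℝ} (hab : a ≤ b) {v : ℝ → F}
    (hv : ContinuousOn v (Ico a b)) (hM : ∀ t ∈ Ico a b, ‖v t‖ ≤ M) (ξ : E) :
    ∃ X : ℝ → E, X a = ξ ∧ SolvesOn (fun t x => f x (v t)) X a (Icc a b) := by
  obtain ⟨σ, hσ, hreach⟩ := hfc.exists_reach_gain (b - a)
  have hfcont := hf.continuous
  set r := max ‖ξ‖ (max M 0)
  have hr : 0 ≤ r := le_max_of_le_left (norm_nonneg _)
  have hvr : ∀ t ∈ Ico a b, ‖v t‖ ≤ r := fun t ht =>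
    (hM t ht).trans (le_max_of_le_right (le_max_left _ _))
  -- While the truncated solution stays below q it solves the true plant, hence is at most σ(r). The
  -- added 1 makes this strictly less than q, so the barrier principle applies and the truncation
  -- never acts.
  set q := max (σ r) ‖ξ‖ + 1
  have hq : 0 < q := by
    have : 0 ≤ max (σ r) ‖ξ‖ := le_max_of_le_right (norm_nonneg _)
    positivity
  set u : ℝ → F := (Ico a b).indicator v
  have hu : Measurable u := hv.measurable_indicator measurableSet_Ico
  have hur : ∀ s, ‖u s‖ ≤ r := fun s => by
    by_cases hs : s ∈ Ico a b
    · simpa [u, indicator_of_mem hs] using hvr s hs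
    · simpa [u, indicator_of_notMem hs] using hr
  have hπ : Continuous (radialRetraction q : E → E) := by
    refine (LipschitzWith.of_dist_le_mul (K := 2) fun x y => ?_).continuous
    rw [dist_eq_norm, dist_eq_norm]
    exact norm_radialRetraction_sub_le hq x y
  obtain ⟨C, hC, hlip⟩ := hf _ _ (isCompact_closedBall (0 : E) q) (isCompact_closedBall (0 : F) r)
  have hmem : ∀ x : E, radialRetraction q x ∈ Metric.closedBall (0 : E) q := fun x => by
    rw [mem_closedBall_zero_iff]; exact norm_radialRetraction_le hq x
  have humem : ∀ s, u s ∈ Metric.closedBall (0 : F) r := fun s => by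
    rw [mem_closedBall_zero_iff]; exact hur s
  obtain ⟨L, hL⟩ := ((isCompact_closedBall (0 : E) q).prod
    (isCompact_closedBall (0 : F) r)).exists_bound_of_continuousOn hfcont.continuousOn
  obtain ⟨X, hXa, hX⟩ := exists_solvesOn_of_lipschitz
    (g := fun s x => f (radialRetraction q x) (u s))
    (C := 2 * C) (M := L) (by positivity)
    (hfcont.measurable.comp
      ((hπ.measurable.comp measurable_snd).prodMk (hu.comp measurable_fst)))
    (fun s x y => by
      have h1 := hlip _ (hmem x) _ (hmem y) _ (humem s) _ (humem s)
      have h2 := norm_radialRetraction_sub_le hq x y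
      rw [sub_self, norm_zero, add_zero] at h1
      nlinarith)
    (fun s x => hL (_, _) ⟨hmem x, humem s⟩) hab ξ
  have hXd : ∀ t ∈ Ico a b, HasDerivWithinAt X (f (radialRetraction q (X t)) (u t)) (Ici t) t := by
    refine hX.hasDerivWithinAt_of_continuousOn Ico_subset_Icc_self ?_
    have huc : ContinuousOn u (Ico a b) := hv.congr fun s hs => indicator_of_mem hs _
    exact hfcont.comp_continuousOn
      ((hπ.comp_continuousOn (hX.1.mono Ico_subset_Icc_self)).prodMk huc)
  have hXq : ∀ t ∈ Icc a b, ‖X t‖ < q := by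
    refine lt_of_forall_lt_imp_lt hX.1.norm fun t ht hlt => ?_
    have := hreach a t r v X (by linarith [ht.2]) (hX.1.mono (Icc_subset_Icc_right ht.2))
      (fun s hs => by
        have hs' : s ∈ Ico a b := ⟨hs.1, hs.2.trans_le ht.2⟩
        have := hXd s hs'
        rwa [radialRetraction_of_norm_le hq (hlt s hs).le,
          show u s = v s from indicator_of_mem hs' _] at this)
      (by rw [hXa]; exact le_max_left _ _)
      (fun s hs => hvr s ⟨hs.1, hs.2.trans_le ht.2⟩) t ⟨ht.1, le_rfl⟩
    exact this.trans_lt ((le_max_left _ _).trans_lt (lt_add_one _))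
  refine ⟨X, hXa, hX.congr ordConnected_Icc ⟨le_rfl, hab⟩ (eqOn_refl _ _) ?_⟩
  filter_upwards [(measure_eq_zero_iff_ae_notMem (μ := volume)).1 (Real.volume_singleton (a := b))]
    with s hsb hs
  have hs' : s ∈ Ico a b := ⟨hs.1, lt_of_le_of_ne hs.2 hsb⟩
  rw [radialRetraction_of_norm_le hq (hXq s hs).le, show u s = v s from indicator_of_mem hs' _]

end Plant

/-! ### Accuracy of the two prediction laws. -/

theorem LipConstOn₂.norm_sub_le {E F : Type*} [NormedAddCommGroup E]
    [NormedAddCommGroup F] {f : E → F → E} {R Cf : ℝ}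
    (hlf : LipConstOn₂ f (Metric.closedBall 0 R) (Metric.closedBall 0 R) Cf)
    {x y : E} {u v : F} (hx : ‖x‖ ≤ R) (hy : ‖y‖ ≤ R) (hu : ‖u‖ ≤ R) (hv : ‖v‖ ≤ R) :
    ‖f x u - f y v‖ ≤ Cf * (‖x - y‖ + ‖u - v‖) :=
  hlf _ (mem_closedBall_zero_iff.2 hx) _ (mem_closedBall_zero_iff.2 hy)
    _ (mem_closedBall_zero_iff.2 hu) _ (mem_closedBall_zero_iff.2 hv)

theorem LipConstOn.norm_sub_le {E F : Type*} [NormedAddCommGroup E]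
    [NormedAddCommGroup F] {κ : E → F} {R Cκ : ℝ}
    (hlκ : LipConstOn κ (Metric.closedBall 0 R) Cκ)
    {x y : E} (hx : ‖x‖ ≤ R) (hy : ‖y‖ ≤ R) : ‖κ x - κ y‖ ≤ Cκ * ‖x - y‖ :=
  hlκ _ (mem_closedBall_zero_iff.2 hx) _ (mem_closedBall_zero_iff.2 hy)

section Laws

variable {E F : Type*} [NormedAddCommGroup E] [NormedSpace ℝ E] [NormedAddCommGroup F]

/-- A prediction law that, over sampling intervals of length in `S`, produces continuous predicted
states whose feedback stays within `Cκ * (c * δ)` of the nominal feedback, as long as the nominal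
trajectory stays well inside the ball of radius `R`. -/
structure AdmissibleLaw (f : E → F → E) (κ : E → F) (ρ : ℝ → ℝ) (D R Cκ c δ : ℝ) (S : Set ℝ)
    (K : Set (E × (ℝ → F))) (law : PredictionLaw E F) : Prop where
  exists_prediction : ∀ x u τ P, (x, u) ∈ K → τ ∈ S → 0 < τ → IsPredictor f D x u P →
    ∃ z, law x u τ z ∧ ContinuousOn z (Ico 0 τ) ∧ ∃ M, ∀ s ∈ Ico 0 τ, ‖z s‖ ≤ M
  step : ∀ x u τ P z Z ζ, (x, u) ∈ K → τ ∈ S → 0 < τ → IsPredictor f D x u P → law x u τ z →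
    SolvesOn (fun _ z => f z (κ z)) Z 0 (Ici 0) → Z 0 = P 0 → (∀ s, 0 ≤ s → ‖Z s‖ ≤ ζ) →
    ζ + 3 * (c * δ) ≤ R → ρ (ζ + 3 * (c * δ)) ≤ R →
    ContinuousOn z (Ico 0 τ) ∧ ∀ y, y 0 = P 0 →
      SolvesOn (fun s y => f y (κ (z s))) y 0 (Icc 0 τ) →
      ∀ s ∈ Ico 0 τ, ‖κ (z s) - κ (y s)‖ ≤ Cκ * (c * δ)
  congr : ∀ x u τ z z', 0 < τ → EqOn z z' (Ico 0 τ) → law x u τ z → law x u τ z'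

variable {f : E → F → E} {κ : E → F} {ρ : ℝ → ℝ} {D R Cf Cκ h ε : ℝ}

/-- The prediction z is ε-close to the nominal Z by assumption. The true y is driven by κ(z) instead
of κ(Z), a forcing of size Cf Cκ ε, so Gronwall puts it within (c - 1) ε of Z. The triangle
inequality gives c ε between z and y. -/
theorem admissibleLaw_operatorLaw [CompleteSpace E]
    (hf : Continuous (Function.uncurry f)) (hκ : Continuous κ)
    (hflow : ∀ ξ, ∃ X : ℝ → E, X 0 = ξ ∧ SolvesOn (fun _ x => f x (κ x)) X 0 (Ici 0))
    (hρ : MonoGain ρ) (hκρ : ∀ x, ‖κ x‖ ≤ ρ ‖x‖) (hCf : 0 ≤ Cf) (hCκ : 0 ≤ Cκ)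
    (hlf : LipConstOn₂ f (Metric.closedBall 0 R) (Metric.closedBall 0 R) Cf)
    (hlκ : LipConstOn κ (Metric.closedBall 0 R) Cκ) (hε : 0 < ε)
    {K : Set (E × (ℝ → F))} {Mhat : E → (ℝ → F) → ℝ → E}
    (hM : ApproxPredictionOperator f κ D h ε K Mhat) :
    AdmissibleLaw f κ ρ D R Cκ (1 + Cκ * Real.exp (Cf * h)) ε {h} K (operatorLaw Mhat) where
  congr := fun x u τ z z' _ hz hl s hs => by rw [← hz hs]; exact hl s hs
  exists_prediction := by
    rintro x u τ P hxu rfl hτ hP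
    obtain ⟨hc, hb⟩ := hM x u hxu
    refine ⟨Mhat x u, fun s _ => rfl, hc, ?_⟩
    obtain ⟨Z, hZ0, hZ⟩ := hflow (P 0)
    obtain ⟨B, hB⟩ := (isCompact_Icc (a := 0) (b := τ)).exists_bound_of_continuousOn
      (hZ.1.mono Icc_subset_Ici_self)
    refine ⟨B + ε, fun s hs => ?_⟩
    have h1 := hb Z ⟨P, hP, hZ0, hZ.mono Ico_subset_Ici_self⟩ s hs
    have h2 := hB s ⟨hs.1, hs.2.le⟩
    have h3 := norm_sub_norm_le (Mhat x u s) (Z s)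
    rw [norm_sub_rev] at h1
    linarith
  step := by
    rintro x u τ P z Z ζ hxu rfl hτ hP hl hZ hZ0 hζ hR hρR
    set c := 1 + Cκ * Real.exp (Cf * τ)
    have hc1 : 1 ≤ c := le_add_of_nonneg_right (by positivity)
    have hcε : ε ≤ c * ε := le_mul_of_one_le_left hε.le hc1
    obtain ⟨hc, hb⟩ := hM x u hxu
    have hzc : ContinuousOn z (Ico 0 τ) := hc.congr hl
    refine ⟨hzc, fun y hy0 hy => ?_⟩
    have hzZ : ∀ s ∈ Ico 0 τ, ‖z s - Z s‖ ≤ ε := fun s hs => by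
      rw [hl s hs, norm_sub_rev]
      exact hb Z ⟨P, hP, hZ0, hZ.mono Ico_subset_Ici_self⟩ s hs
    have hnorm : ∀ {p : E} {s d : ℝ}, 0 ≤ s → ‖p - Z s‖ ≤ d → d ≤ 3 * (c * ε) →
        ‖p‖ ≤ ζ + 3 * (c * ε) := fun {p s d} hs hp hd => by
      have := norm_sub_norm_le p (Z s)
      linarith [hζ s hs]
    have hκR : ∀ {p : E}, ‖p‖ ≤ ζ + 3 * (c * ε) → ‖κ p‖ ≤ R := fun {p} hp =>
      (hκρ p).trans ((hρ.mono (norm_nonneg _) hp).trans hρR)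
    have hyd := hy.hasDerivWithinAt_of_continuousOn (a := 0) (b := τ) Ico_subset_Icc_self
      (hf.comp_continuousOn ((hy.1.mono Ico_subset_Icc_self).prodMk (hκ.comp_continuousOn hzc)))
    have hZd := hZ.hasDerivWithinAt_of_continuousOn (a := 0) (b := τ) Ico_subset_Ici_self
      (hf.comp_continuousOn ((hZ.1.mono Ico_subset_Ici_self).prodMk
        (hκ.comp_continuousOn (hZ.1.mono Ico_subset_Ici_self))))
    have hG : ∀ t ∈ Icc 0 τ, gronwallBound 0 Cf (Cf * (Cκ * ε)) (t - 0) ≤ (c - 1) * ε := by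
      intro t ht
      refine (gronwallBound_zero_mul_le (by positivity)).trans ?_
      have : Real.exp (Cf * (t - 0)) ≤ Real.exp (Cf * τ) :=
        Real.exp_le_exp.2 (mul_le_mul_of_nonneg_left (by linarith [ht.2]) hCf)
      calc Cκ * ε * Real.exp (Cf * (t - 0)) ≤ Cκ * ε * Real.exp (Cf * τ) := by gcongr
        _ = (c - 1) * ε := by simp only [c]; ring
    have hyZ := norm_sub_le_gronwallBound_of_barrier (K := Cf) (e := Cf * (Cκ * ε)) (d := 0)
      (q := c * ε) hy.1 (hZ.1.mono Icc_subset_Ici_self) hyd hZd (by rw [hy0, hZ0]; simp)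
      (fun t ht hlt => by
        have h1 := hlf.norm_sub_le (x := y t) (y := Z t) (u := κ (z t)) (v := κ (Z t))
          ((hnorm ht.1 hlt.le (by linarith)).trans hR)
          ((hnorm ht.1 (d := 0) (by simp) (by linarith)).trans hR)
          (hκR (hnorm ht.1 (hzZ t ht) (by linarith)))
          (hκR (hnorm ht.1 (d := 0) (by simp) (by linarith)))
        have h2 := hlκ.norm_sub_le (x := z t) (y := Z t)
          ((hnorm ht.1 (hzZ t ht) (by linarith)).trans hR)
          ((hnorm ht.1 (d := 0) (by simp) (by linarith)).trans hR)
        have h3 := mul_le_mul_of_nonneg_left (hzZ t ht) hCκ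
        have h4 := mul_le_mul_of_nonneg_left (h2.trans h3) hCf
        linarith)
      (fun t ht => (hG t ht).trans_lt (by linarith))
    intro s hs
    have hs' : s ∈ Icc 0 τ := ⟨hs.1, hs.2.le⟩
    have h1 := (hyZ s hs').trans (hG s hs')
    have h2 := hlκ.norm_sub_le (x := z s) (y := y s)
      ((hnorm hs.1 (hzZ s hs) (by linarith)).trans hR)
      ((hnorm hs.1 h1 (by linarith)).trans hR)
    refine h2.trans (mul_le_mul_of_nonneg_left ?_ hCκ)
    have h3 := norm_sub_le_norm_sub_add_norm_sub (z s) (Z s) (y s)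
    rw [norm_sub_rev (Z s)] at h3
    linarith [hzZ s hs]

/-- All deviation comes from the initial error ε. Since z and Z solve the same closed-loop equation,
with Lipschitz constant Cf (1 + Cκ), they stay δ-close, which keeps z in the ball. The trajectories
y and z share the input κ(z), so comparing them directly costs only the rate Cf and again gives δ,
hence c = 1. -/
theorem admissibleLaw_predictorLaw [CompleteSpace E]
    (hf : Continuous (Function.uncurry f)) (hκ : Continuous κ) (hD : 0 < D)
    (hflow : ∀ ξ, ∃ X : ℝ → E, X 0 = ξ ∧ SolvesOn (fun _ x => f x (κ x)) X 0 (Ici 0))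
    (hρ : MonoGain ρ) (hκρ : ∀ x, ‖κ x‖ ≤ ρ ‖x‖) (hCf : 0 ≤ Cf) (hCκ : 0 ≤ Cκ)
    (hlf : LipConstOn₂ f (Metric.closedBall 0 R) (Metric.closedBall 0 R) Cf)
    (hlκ : LipConstOn κ (Metric.closedBall 0 R) Cκ) (hε : 0 < ε)
    {K : Set (E × (ℝ → F))} {Phat : E → (ℝ → F) → ℝ → E}
    (hPhat : ApproxPredictor f D ε K Phat) :
    AdmissibleLaw f κ ρ D R Cκ 1 (ε * Real.exp (Cf * (1 + Cκ) * h)) (Iic h) K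
      (predictorLaw f κ Phat) where
  congr := by
    rintro x u τ z z' hτ hz ⟨hl0, hl⟩
    refine ⟨by rw [← hz ⟨le_rfl, hτ⟩, hl0], ?_⟩
    exact hl.congr ordConnected_Ico ⟨le_rfl, hτ⟩ hz (Eventually.of_forall fun _ _ => rfl)
  exists_prediction := by
    intro x u τ P hxu hτh hτ hP
    obtain ⟨Z, hZ0, hZ⟩ := hflow (Phat x u 0)
    obtain ⟨B, hB⟩ := (isCompact_Icc (a := 0) (b := τ)).exists_bound_of_continuousOn
      (hZ.1.mono Icc_subset_Ici_self)
    exact ⟨Z, ⟨hZ0, hZ.mono Ico_subset_Ici_self⟩, hZ.1.mono Ico_subset_Ici_self, B,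
      fun s hs => hB s ⟨hs.1, hs.2.le⟩⟩
  step := by
    intro x u τ P z Z ζ hxu hτh hτ hP hl hZ hZ0 hζ hR hρR
    set δ := ε * Real.exp (Cf * (1 + Cκ) * h)
    rw [one_mul] at *
    have hδ : 0 < δ := by positivity
    obtain ⟨hz0, hz⟩ := hl
    refine ⟨hz.1, fun y hy0 hy => ?_⟩
    have hnorm : ∀ {p : E} {s d : ℝ}, 0 ≤ s → ‖p - Z s‖ ≤ d → d ≤ 3 * δ →
        ‖p‖ ≤ ζ + 3 * δ := fun {p s d} hs hp hd => by
      have := norm_sub_norm_le p (Z s)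
      linarith [hζ s hs]
    have hκR : ∀ {p : E}, ‖p‖ ≤ ζ + 3 * δ → ‖κ p‖ ≤ R := fun {p} hp =>
      (hκρ p).trans ((hρ.mono (norm_nonneg _) hp).trans hρR)
    have hexp : ∀ {C t : ℝ}, 0 ≤ C → C ≤ Cf * (1 + Cκ) → t ≤ τ →
        ε * Real.exp (C * (t - 0)) ≤ δ := by
      intro C t hC hCL ht
      have hL : 0 ≤ Cf * (1 + Cκ) := by positivity
      have : C * (t - 0) ≤ Cf * (1 + Cκ) * h := by
        have h1 : C * (t - 0) ≤ C * τ := mul_le_mul_of_nonneg_left (by linarith) hC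
        have h2 : C * τ ≤ Cf * (1 + Cκ) * h :=
          mul_le_mul hCL hτh hτ.le hL
        linarith
      exact mul_le_mul_of_nonneg_left (Real.exp_le_exp.2 this) hε.le
    -- The prediction is a solution only on [0, τ), so the Gronwall estimates are run on [0, t] with
    -- t < τ.
    intro t ht
    have hsub : Icc 0 t ⊆ Ico 0 τ := fun s hs => ⟨hs.1, hs.2.trans_lt ht.2⟩
    have hsub' : Ico 0 t ⊆ Ico 0 τ := Ico_subset_Ico_right ht.2.le
    have hzd := hz.hasDerivWithinAt_of_continuousOn (a := 0) (b := t) hsub'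
      (hf.comp_continuousOn ((hz.1.mono hsub').prodMk (hκ.comp_continuousOn (hz.1.mono hsub'))))
    have hyd := hy.hasDerivWithinAt_of_continuousOn (a := 0) (b := t)
      (hsub'.trans Ico_subset_Icc_self)
      (hf.comp_continuousOn ((hy.1.mono (hsub'.trans Ico_subset_Icc_self)).prodMk
        (hκ.comp_continuousOn (hz.1.mono hsub'))))
    have hZd := hZ.hasDerivWithinAt_of_continuousOn (a := 0) (b := t) Ico_subset_Ici_self
      (hf.comp_continuousOn ((hZ.1.mono Ico_subset_Ici_self).prodMk
        (hκ.comp_continuousOn (hZ.1.mono Ico_subset_Ici_self))))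
    have hP0 : ‖P 0 - Phat x u 0‖ ≤ ε := hPhat x u hxu P hP 0 ⟨by linarith, le_rfl⟩
    have hCfL : Cf ≤ Cf * (1 + Cκ) := le_mul_of_one_le_right hCf (by linarith)
    have hzZ : ∀ s ∈ Icc 0 t, ‖z s - Z s‖ ≤ δ := by
      have := norm_sub_le_gronwallBound_of_barrier (K := Cf * (1 + Cκ)) (e := 0) (d := ε)
        (q := 2 * δ) (hz.1.mono hsub) (hZ.1.mono Icc_subset_Ici_self) hzd hZd
        (by rw [hZ0, hz0, norm_sub_rev]; exact hP0)
        (fun s hs hlt => by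
          have hzn := hnorm hs.1 hlt.le (by linarith)
          have hZn := hnorm hs.1 (p := Z s) (d := 0) (by simp) (by linarith)
          have h1 := hlf.norm_sub_le (hzn.trans hR) (hZn.trans hR) (hκR hzn) (hκR hZn)
          have h2 := hlκ.norm_sub_le (hzn.trans hR) (hZn.trans hR)
          have h4 := mul_le_mul_of_nonneg_left h2 hCf
          linarith)
        (fun s hs => by
          rw [gronwallBound_ε0]
          have := hexp (by positivity) le_rfl (hs.2.trans ht.2.le)
          linarith)
      intro s hs
      have h1 := this s hs
      rw [gronwallBound_ε0] at h1
      exact h1.trans (hexp (by positivity) le_rfl (hs.2.trans ht.2.le))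
    -- Below the barrier 2δ for y - z, the bound δ for z - Z keeps y within 3δ of Z; this is the
    -- margin demanded of ζ.
    have hyz : ‖y t - z t‖ ≤ δ := by
      have := norm_sub_le_gronwallBound_of_barrier (K := Cf) (e := 0) (d := ε)
        (q := 2 * δ) (hy.1.mono (hsub.trans Ico_subset_Icc_self)) (hz.1.mono hsub) hyd hzd
        (by rw [hy0, hz0]; exact hP0)
        (fun s hs hlt => by
          have hs' : s ∈ Icc 0 t := ⟨hs.1, hs.2.le⟩
          have hzn := hnorm hs.1 (hzZ s hs') (by linarith)
          have hyn := hnorm hs.1 (p := y s) (d := 3 * δ) (by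
            have := norm_sub_le_norm_sub_add_norm_sub (y s) (z s) (Z s)
            linarith [hzZ s hs']) le_rfl
          have h1 := hlf.norm_sub_le (hyn.trans hR) (hzn.trans hR) (hκR hzn) (hκR hzn)
          rw [sub_self, norm_zero, add_zero] at h1
          linarith)
        (fun s hs => by
          rw [gronwallBound_ε0]
          have := hexp hCf hCfL (hs.2.trans ht.2.le)
          linarith) t ⟨ht.1, le_rfl⟩
      rw [gronwallBound_ε0] at this
      exact this.trans (hexp hCf hCfL ht.2.le)
    have htt : t ∈ Icc 0 t := ⟨ht.1, le_rfl⟩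
    have hzn := hnorm ht.1 (hzZ t htt) (by linarith)
    have hyn := hnorm ht.1 (p := y t) (d := 3 * δ) (by
      have := norm_sub_le_norm_sub_add_norm_sub (y t) (z t) (Z t)
      linarith [hzZ t htt]) le_rfl
    refine (hlκ.norm_sub_le (hzn.trans hR) (hyn.trans hR)).trans
      (mul_le_mul_of_nonneg_left ?_ hCκ)
    rw [norm_sub_rev]
    exact hyz

end Laws

/-! ### The sampled closed loop and its gains. -/

theorem ae_ne (b : ℝ) : ∀ᵐ s : ℝ, s ≠ b := by
  have := (measure_eq_zero_iff_ae_notMem (μ := volume)).1 (Real.volume_singleton (a := b))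
  filter_upwards [this] with s hs using hs

section Loop

variable {E F : Type*} [NormedAddCommGroup E] [NormedSpace ℝ E] [NormedAddCommGroup F]

/-- Transient gain of the sampled closed loop. -/
noncomputable def transientGain (β : ℝ → ℝ → ℝ) (σ ρ : ℝ → ℝ) (D r t : ℝ) : ℝ :=
  β (σ r) (max (t - D) 0) + ρ (2 * β (σ r) (max (t - D) 0)) + Real.exp (D - t) * (σ r + r)

/-- Residual gain of the sampled closed loop. -/
noncomputable def residualGain (γ ρ : ℝ → ℝ) (Cκ c s : ℝ) : ℝ :=
  γ (Cκ * (c * s)) + ρ (2 * (γ (Cκ * (c * s)) + 3 * (c * s))) + Cκ * (c * s) + 3 * (c * s) + s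

/-- A closed-loop solution up to `T N` whose plant trajectory is known for the whole time covered
by the inputs. -/
structure ExtendedLoop (f : E → F → E) (κ : E → F) (D : ℝ) (T : ℕ → ℝ)
    (law : PredictionLaw E F) (X₀ : E) (U₀ : ℝ → F)
    (X : ℝ → E) (U : ℝ → F) (Zhat : ℝ → E) (N : ℕ) : Prop
    extends ClosedLoopUpTo f κ D T law X₀ U₀ X U Zhat N where
  plant_extended : SolvesOn (fun t x => f x (U (t - D))) X 0 (Icc 0 (T N + D))

/-- Regularity of the input and size of the deviation from the nominal feedback. -/
structure TracksFeedback (κ : E → F) (D : ℝ) (T : ℕ → ℝ) (B : ℝ) (X : ℝ → E) (U : ℝ → F)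
    (N : ℕ) : Prop where
  continuousOn : ∀ i < N, ContinuousOn U (Ico (T i) (T (i + 1)))
  error_le : ∀ t ∈ Ico 0 (T N), ‖U t - κ (X (t + D))‖ ≤ B

theorem norm_le_supNormOn {F : Type*} [NormedAddCommGroup F] {U : ℝ → F} {a b : ℝ}
    (hU : ContinuousOn U (Icc a b)) {θ : ℝ}
    (hθ : θ ∈ Icc a b) : ‖U θ‖ ≤ supNormOn U a b :=
  le_csSup (isCompact_Icc.image_of_continuousOn hU.norm).bddAbove ⟨θ, hθ, rfl⟩

theorem supNormOn_nonneg {F : Type*} [NormedAddCommGroup F] (U : ℝ → F) (a b : ℝ) :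
    0 ≤ supNormOn U a b :=
  Real.sSup_nonneg (by rintro _ ⟨θ, -, rfl⟩; exact norm_nonneg _)

variable {f : E → F → E} {κ : E → F} {D : ℝ} {T : ℕ → ℝ} {law : PredictionLaw E F} {X₀ : E}
  {U₀ : ℝ → F} {X X' : ℝ → E} {U U' : ℝ → F}
  {Zhat Zhat' : ℝ → E} {N M : ℕ}

theorem ClosedLoopUpTo.mono (hT : Monotone T)
    (h : ClosedLoopUpTo f κ D T law X₀ U₀ X U Zhat N) (hMN : M ≤ N) :
    ClosedLoopUpTo f κ D T law X₀ U₀ X U Zhat M where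
  init_state := h.init_state
  init_input := h.init_input
  plant := h.plant.mono (Icc_subset_Icc_right (hT hMN))
  prediction i hi := h.prediction i (hi.trans_le hMN)
  control i hi := h.control i (hi.trans_le hMN)

theorem ExtendedLoop.mono (hT : Monotone T)
    (h : ExtendedLoop f κ D T law X₀ U₀ X U Zhat N) (hMN : M ≤ N) :
    ExtendedLoop f κ D T law X₀ U₀ X U Zhat M :=
  { h.toClosedLoopUpTo.mono hT hMN with
    plant_extended := h.plant_extended.mono
      (Icc_subset_Icc_right (by linarith [hT hMN])) }

theorem IsSamplingSequence.nonneg (hT : IsSamplingSequence T) (N : ℕ) : 0 ≤ T N := by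
  rw [← hT.1]; exact hT.2.1.monotone (Nat.zero_le N)

theorem inputHistory_congr {F : Type*} [NormedAddCommGroup F] {D t : ℝ} {U U' : ℝ → F}
    (h : EqOn U U' (Iio t)) :
    inputHistory D U t = inputHistory D U' t := by
  ext1 θ
  by_cases hθ : θ ∈ Ico (-D) 0
  · rw [inputHistory, inputHistory, indicator_of_mem hθ, indicator_of_mem hθ]
    exact h (by simpa using hθ.2)
  · rw [inputHistory, inputHistory, indicator_of_notMem hθ, indicator_of_notMem hθ]

/-- Up to T N the loop involves states up to T N, but inputs and predictions strictly before it.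
Later values may be altered freely, which permits extension and gluing. -/
theorem ClosedLoopUpTo.congr (hT : IsSamplingSequence T) (hD : 0 < D)
    (hlaw : ∀ x u τ z z', 0 < τ → EqOn z z' (Ico 0 τ) → law x u τ z → law x u τ z')
    (h : ClosedLoopUpTo f κ D T law X₀ U₀ X U Zhat N) (hX : EqOn X X' (Iic (T N)))
    (hU : EqOn U U' (Iio (T N))) (hZ : EqOn Zhat Zhat' (Iio (T N))) :
    ClosedLoopUpTo f κ D T law X₀ U₀ X' U' Zhat' N where
  init_state := by rw [← hX (hT.nonneg N), h.init_state]
  init_input θ hθ := by rw [← hU (hθ.2.trans_le (hT.nonneg N)), h.init_input θ hθ]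
  plant := by
    refine h.plant.congr ordConnected_Icc ⟨le_rfl, hT.nonneg N⟩ (fun t ht => hX ht.2) ?_
    refine Eventually.of_forall fun s hs => ?_
    rw [hU (show s - D < T N by linarith [hs.2])]
  prediction i hi := by
    have hlt : T (i + 1) ≤ T N := hT.2.1.monotone hi
    have hlt' : T i < T (i + 1) := hT.2.1 (Nat.lt_succ_self i)
    have h1 := h.prediction i hi
    rw [hX (hlt'.le.trans hlt),
      inputHistory_congr (hU.mono (Iio_subset_Iio (hlt'.le.trans hlt)))] at h1
    refine hlaw _ _ _ _ _ (sub_pos.2 hlt') (fun s hs => hZ ?_) h1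
    exact (show T i + s < T N by linarith [hs.2])
  control i hi t ht := by
    have hlt : t < T N := ht.2.trans_le (hT.2.1.monotone hi)
    rw [← hU hlt, ← hZ hlt, h.control i hi t ht]

end Loop

section SampledLoop

variable {E F : Type*} [NormedAddCommGroup E] [NormedSpace ℝ E] [NormedAddCommGroup F]

/-- The gains of the plant and of the nominal feedback. -/
structure PlantGains [MeasurableSpace F] (f : E → F → E) (κ : E → F) (D : ℝ) (β : ℝ → ℝ → ℝ)
    (γ σ ρ : ℝ → ℝ) : Prop where
  D_pos : 0 < D
  lip : LipschitzOnCompacts f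
  complete : StronglyForwardComplete f
  continuous_feedback : Continuous κ
  flow : ∀ ξ, ∃ X : ℝ → E, X 0 = ξ ∧ SolvesOn (fun _ x => f x (κ x)) X 0 (Ici 0)
  classKL : ClassKL β
  gain_disturbance : MonoGain γ
  iss : ∀ (w : ℝ → F) (B : ℝ) (X : ℝ → E), Measurable w → 0 ≤ B → (∀ s, ‖w s‖ ≤ B) →
    SolvesOn (fun s x => f x (κ x + w s)) X 0 (Ici 0) → ∀ t, 0 ≤ t → ‖X t‖ ≤ β ‖X 0‖ t + γ B
  gain_reach : MonoGain σ
  reach : ∀ (a b r : ℝ) (v : ℝ → F) (Y : ℝ → E), b - a ≤ D →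
    ContinuousOn Y (Icc a b) →
    (∀ t ∈ Ico a b, HasDerivWithinAt Y (f (Y t) (v t)) (Ici t) t) →
    ‖Y a‖ ≤ r → (∀ t ∈ Ico a b, ‖v t‖ ≤ r) → ∀ t ∈ Icc a b, ‖Y t‖ ≤ σ r
  gain_feedback : MonoGain ρ
  feedback_le : ∀ x, ‖κ x‖ ≤ ρ ‖x‖

variable [MeasurableSpace F] {f : E → F → E} {κ : E → F} {D : ℝ} {β : ℝ → ℝ → ℝ}
  {γ σ ρ : ℝ → ℝ}

/-- The stability estimate along a perturbed trajectory and along the nominal trajectory that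
continues it. -/
theorem PlantGains.iss_bound [BorelSpace F] [SecondCountableTopology F]
    (H : PlantGains f κ D β γ σ ρ)
    {Y Z : ℝ → E} {U : ℝ → F} {τ B : ℝ} (hτ : 0 ≤ τ)
    (hU : Measurable ((Ico 0 τ).indicator U))
    (hY : SolvesOn (fun t y => f y (U t)) Y 0 (Icc 0 τ)) (hB : 0 ≤ B)
    (hw : ∀ t ∈ Ico 0 τ, ‖U t - κ (Y t)‖ ≤ B)
    (hZ : SolvesOn (fun _ z => f z (κ z)) Z 0 (Ici 0)) (hZ0 : Z 0 = Y τ) :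
    (∀ t ∈ Icc 0 τ, ‖Y t‖ ≤ β ‖Y 0‖ t + γ B) ∧
      ∀ s, 0 ≤ s → ‖Z s‖ ≤ β ‖Y 0‖ (τ + s) + γ B := by
  classical
  set w : ℝ → F := (Ico 0 τ).indicator (fun t => U t - κ (Y t)) with hwdef
  -- One trajectory carries both claims: Y followed by Z solves the perturbed system with a
  -- disturbance that is switched off at τ. A single stability estimate thus covers Z, without
  -- restarting from Y(τ) and composing gains.
  set W : ℝ → E := fun t => if t ≤ τ then Y t else Z (t + -τ) with hWdef
  have hwm : Measurable w := by
    have h1 : Measurable ((Ico 0 τ).indicator (fun t => κ (Y t))) :=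
      (H.continuous_feedback.comp_continuousOn
        (hY.1.mono Ico_subset_Icc_self)).measurable_indicator measurableSet_Ico
    have : w = fun t => (Ico 0 τ).indicator U t - (Ico 0 τ).indicator (fun t => κ (Y t)) t := by
      ext1 t
      by_cases ht : t ∈ Ico 0 τ <;> simp [hwdef, ht]
    rw [this]
    exact hU.sub h1
  have hwB : ∀ s, ‖w s‖ ≤ B := fun s => by
    by_cases hs : s ∈ Ico 0 τ
    · simpa [hwdef, indicator_of_mem hs] using hw s hs
    · simpa [hwdef, indicator_of_notMem hs] using hB
  have hW0 : ∀ t, t ≤ τ → W t = Y t := fun t ht => if_pos ht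
  have hW1 : ∀ s, 0 ≤ s → W (τ + s) = Z s := fun s hs => by
    rcases hs.eq_or_lt with rfl | hs
    · rw [add_zero, hW0 τ le_rfl, hZ0]
    · simp only [hWdef]
      rw [if_neg (by linarith)]
      congr 1
      ring
  have h1 : SolvesOn (fun s x => f x (κ x + w s)) W 0 (Icc 0 τ) := by
    refine hY.congr ordConnected_Icc ⟨le_rfl, hτ⟩ (fun t ht => (hW0 t ht.2).symm) ?_
    filter_upwards [ae_ne τ] with s hsτ hs
    have : s ∈ Ico 0 τ := ⟨hs.1, lt_of_le_of_ne hs.2 hsτ⟩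
    simp [hwdef, indicator_of_mem this]
  have h2 : SolvesOn (fun s x => f x (κ x + w s)) W τ (Ici τ) := by
    have := hZ.shift (J := Ici τ) (-τ) (fun t ht => by simpa using ht)
    rw [zero_sub, neg_neg] at this
    refine this.congr ordConnected_Ici self_mem_Ici (fun t ht => ?_) ?_
    · have := hW1 (t - τ) (sub_nonneg.2 ht)
      rw [add_sub_cancel] at this
      simp only [this, sub_eq_add_neg]
    · refine Eventually.of_forall fun s hs => ?_
      have : s ∉ Ico 0 τ := fun h => absurd h.2 (not_lt.2 hs)
      simp [hwdef, indicator_of_notMem this]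
  have h3 := h1.union h2 ⟨hτ, le_rfl⟩ isClosed_Icc isClosed_Ici
  rw [Icc_union_Ici_eq_Ici hτ] at h3
  have h4 := H.iss w B W hwm hB hwB h3
  rw [hW0 0 hτ] at h4
  refine ⟨fun t ht => ?_, fun s hs => ?_⟩
  · rw [← hW0 t ht.2]; exact h4 t ht.1
  · rw [← hW1 s hs]; exact h4 _ (by positivity)

/-- The data of a sampled closed loop with an admissible prediction law. -/
structure SampledLoop (f : E → F → E) (κ : E → F) (D : ℝ) (β : ℝ → ℝ → ℝ) (γ σ ρ : ℝ → ℝ)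
    (R Cκ c δ : ℝ) (S : Set ℝ) (K : Set (E × (ℝ → F))) (law : PredictionLaw E F) (T : ℕ → ℝ)
    (X₀ : E) (U₀ : ℝ → F) : Prop extends PlantGains f κ D β γ σ ρ where
  admissible : AdmissibleLaw f κ ρ D R Cκ c δ S K law
  sampling : IsSamplingSequence T
  sampling_mem : ∀ i, T (i + 1) - T i ∈ S
  lip_nonneg : 0 ≤ Cκ
  one_le : 1 ≤ c
  error_pos : 0 < δ
  preset : ContinuousOn U₀ (Icc (-D) 0)
  covers : CoversVisitedData f κ D T law R K X₀ U₀
  small : transientGain β σ ρ D (‖X₀‖ + supNormOn U₀ (-D) 0) 0 + residualGain γ ρ Cκ c δ ≤ R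

end SampledLoop

/-! ### A priori estimates along the sampled loop. -/

section Estimates

variable {E F : Type*} [NormedAddCommGroup E] [NormedSpace ℝ E] [NormedAddCommGroup F]
  {f : E → F → E} {κ : E → F} {D : ℝ} {T : ℕ → ℝ}
  {law : PredictionLaw E F} {X₀ : E} {U₀ : ℝ → F} {X : ℝ → E} {U : ℝ → F}
  {Zhat : ℝ → E} {N : ℕ} {B : ℝ}

theorem ClosedLoopUpTo.continuousOn_history (h : ClosedLoopUpTo f κ D T law X₀ U₀ X U Zhat N)
    (hU₀ : ContinuousOn U₀ (Icc (-D) 0)) : ContinuousOn U (Ico (-D) 0) :=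
  (hU₀.mono Ico_subset_Icc_self).congr h.init_input

/-- The input is continuous on each of finitely many sampling intervals. Measurability is needed
because the stability estimate is assumed for measurable disturbances. -/
theorem TracksFeedback.measurable_indicator {E F : Type*} [NormedAddCommGroup F] {κ : E → F}
    {D B : ℝ} {T : ℕ → ℝ} {X : ℝ → E} {U : ℝ → F} {N : ℕ} [MeasurableSpace F] [BorelSpace F]
    [SecondCountableTopology F] (hT : IsSamplingSequence T)
    (g : TracksFeedback κ D T B X U N) : Measurable ((Ico 0 (T N)).indicator U) := by
  have : ∀ M ≤ N, Measurable ((Ico 0 (T M)).indicator U) := by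
    intro M
    induction M with
    | zero => intro _; simp [hT.1, measurable_const]
    | succ M ih =>
      intro hM
      have h1 := ih (Nat.le_of_succ_le hM)
      have h2 := (g.continuousOn M hM).measurable_indicator measurableSet_Ico
      rw [← Ico_union_Ico_eq_Ico (hT.nonneg M) (hT.2.1 (Nat.lt_succ_self M)).le,
        indicator_union_of_disjoint (Ico_disjoint_Ico_same)]
      exact h1.add h2
  exact this N le_rfl

variable {β : ℝ → ℝ → ℝ} {γ σ ρ : ℝ → ℝ} {R Cκ c δ : ℝ} {S : Set ℝ} {K : Set (E × (ℝ → F))}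

theorem ClassKL.mono_left (hβ : ClassKL β) {r s t : ℝ} (ht : 0 ≤ t) (hr : 0 ≤ r) (hrs : r ≤ s) :
    β r t ≤ β s t :=
  (hβ.1 t ht).monoGain.mono hr hrs

theorem ClassKL.anti_right (hβ : ClassKL β) {s t t' : ℝ} (hs : 0 ≤ s) (ht : 0 ≤ t) (htt : t ≤ t') :
    β s t' ≤ β s t :=
  (hβ.2 s hs).1 ht (ht.trans htt) htt

theorem ClassKL.nonneg (hβ : ClassKL β) {s t : ℝ} (hs : 0 ≤ s) (ht : 0 ≤ t) : 0 ≤ β s t :=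
  (hβ.1 t ht).monoGain.nonneg hs

theorem transientGain_anti (hβ : ClassKL β) (hσ : MonoGain σ) (hρ : MonoGain ρ) {r t t' : ℝ}
    (hr : 0 ≤ r) (htt : t ≤ t') : transientGain β σ ρ D r t' ≤ transientGain β σ ρ D r t := by
  have hσr := hσ.nonneg hr
  have hb : β (σ r) (max (t' - D) 0) ≤ β (σ r) (max (t - D) 0) :=
    hβ.anti_right hσr (le_max_right _ _) (max_le_max (by linarith) le_rfl)
  have hb0 : 0 ≤ β (σ r) (max (t' - D) 0) := hβ.nonneg hσr (le_max_right _ _)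
  have hρb := hρ.mono (show 0 ≤ 2 * β (σ r) (max (t' - D) 0) by positivity)
    (mul_le_mul_of_nonneg_left hb zero_le_two)
  have he : Real.exp (D - t') ≤ Real.exp (D - t) := Real.exp_le_exp.2 (by linarith)
  have := mul_le_mul_of_nonneg_right he (show 0 ≤ σ r + r by positivity)
  simp only [transientGain]
  linarith

theorem ExtendedLoop.solvesOn_shift
    (h : ExtendedLoop f κ D T law X₀ U₀ X U Zhat N) {a : ℝ} (ha : a ∈ Icc (-D) (T N))
    {J : Set ℝ} (hJ : J ⊆ Icc (-D) (T N)) :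
    SolvesOn (fun t x => f x (U t)) (fun t => X (t + D)) a J := by
  have hmem : ∀ t ∈ Icc (-D) (T N), t + D ∈ Icc 0 (T N + D) := fun t ht =>
    ⟨by linarith [ht.1], by linarith [ht.2]⟩
  have := (h.plant_extended.rebase (hmem a ha)).shift (J := J) D fun t ht => hmem t (hJ ht)
  simpa using this

section

variable [MeasurableSpace F]

namespace SampledLoop

theorem norm_initial_le [CompleteSpace E] [ProperSpace E] [ProperSpace F]
    (H : SampledLoop f κ D β γ σ ρ R Cκ c δ S K law T X₀ U₀)
    (h : ExtendedLoop f κ D T law X₀ U₀ X U Zhat N) :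
    ∀ t ∈ Icc 0 D, ‖X t‖ ≤ σ (‖X₀‖ + supNormOn U₀ (-D) 0) := by
  have hsub : Icc 0 D ⊆ Icc 0 (T N + D) :=
    Icc_subset_Icc_right (by linarith [H.sampling.nonneg N])
  have hX := h.plant_extended.mono hsub
  have hmem : ∀ s ∈ Ico 0 D, s - D ∈ Ico (-D) 0 := fun s hs =>
    ⟨by linarith [hs.1], by linarith [hs.2]⟩
  have hUc : ContinuousOn (fun s => U (s - D)) (Ico 0 D) :=
    (h.continuousOn_history H.preset).comp (by fun_prop) hmem
  have hd := hX.hasDerivWithinAt_of_continuousOn (a := 0) (b := D) Ico_subset_Icc_self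
    (H.lip.continuous.comp_continuousOn ((hX.1.mono Ico_subset_Icc_self).prodMk hUc))
  refine H.reach 0 D _ _ X (by simp) hX.1 hd ?_ fun t ht => ?_
  · rw [h.init_state]
    exact le_add_of_nonneg_right (supNormOn_nonneg _ _ _)
  · rw [h.init_input _ (hmem t ht)]
    have := norm_le_supNormOn H.preset (Ico_subset_Icc_self (hmem t ht))
    linarith [norm_nonneg X₀]

theorem residual_nonneg (H : SampledLoop f κ D β γ σ ρ R Cκ c δ S K law T X₀ U₀) :
    0 ≤ Cκ * (c * δ) :=
  mul_nonneg H.lip_nonneg (mul_nonneg (zero_le_one.trans H.one_le) H.error_pos.le)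

/-- The stability estimate is started at time D, when the inputs computed by the controller begin to
act. Its initial state X(D) is bounded by `norm_initial_le`, which explains the composition of β
with σ. -/
theorem norm_le_of_tracksFeedback [ProperSpace E] [ProperSpace F] [BorelSpace F]
    (H : SampledLoop f κ D β γ σ ρ R Cκ c δ S K law T X₀ U₀)
    (h : ExtendedLoop f κ D T law X₀ U₀ X U Zhat N)
    (g : TracksFeedback κ D T (Cκ * (c * δ)) X U N) {Z : ℝ → E}
    (hZ : SolvesOn (fun _ z => f z (κ z)) Z 0 (Ici 0)) (hZ0 : Z 0 = X (T N + D)) :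
    (∀ t ∈ Icc 0 (T N), ‖X (t + D)‖ ≤
      β (σ (‖X₀‖ + supNormOn U₀ (-D) 0)) t + γ (Cκ * (c * δ))) ∧
    ∀ s, 0 ≤ s → ‖Z s‖ ≤ β (σ (‖X₀‖ + supNormOn U₀ (-D) 0)) 0 + γ (Cκ * (c * δ)) := by
  have hN := H.sampling.nonneg N
  have hD := H.D_pos
  obtain ⟨h1, h2⟩ := H.iss_bound hN (g.measurable_indicator H.sampling)
    (h.solvesOn_shift (a := 0) ⟨by linarith, hN⟩ (Icc_subset_Icc_left (by linarith)))
    H.residual_nonneg g.error_le hZ hZ0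
  have hX0 : ‖X (0 + D)‖ ≤ σ (‖X₀‖ + supNormOn U₀ (-D) 0) := by
    rw [zero_add]; exact H.norm_initial_le h D ⟨hD.le, le_rfl⟩
  refine ⟨fun t ht => (h1 t ht).trans ?_, fun s hs => (h2 s hs).trans ?_⟩
  · linarith [H.classKL.mono_left ht.1 (norm_nonneg _) hX0]
  · have := H.classKL.mono_left (show 0 ≤ T N + s by positivity) (norm_nonneg _) hX0
    have := H.classKL.anti_right ((norm_nonneg _).trans hX0) le_rfl (show 0 ≤ T N + s by positivity)
    linarith

/-- For 0 ≤ θ the input is within Cκ c δ of κ(X(θ + D)), and θ + D ≥ t, so the decay reached at time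
t controls it. The value at θ = T N is excluded because the loop up to T N does not determine it. -/
theorem norm_add_norm_le [ProperSpace E] [ProperSpace F] [BorelSpace F]
    (H : SampledLoop f κ D β γ σ ρ R Cκ c δ S K law T X₀ U₀)
    (h : ExtendedLoop f κ D T law X₀ U₀ X U Zhat N)
    (g : TracksFeedback κ D T (Cκ * (c * δ)) X U N) {t θ : ℝ} (ht : t ∈ Icc 0 (T N))
    (hθ : θ ∈ Icc (t - D) t) (hθN : θ < T N) :
    ‖X t‖ + ‖U θ‖ ≤ transientGain β σ ρ D (‖X₀‖ + supNormOn U₀ (-D) 0) t +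
      residualGain γ ρ Cκ c δ := by
  have hD := H.D_pos
  have hβ := H.classKL
  obtain ⟨Z, hZ0, hZ⟩ := H.flow (X (T N + D))
  obtain ⟨hb, -⟩ := H.norm_le_of_tracksFeedback h g hZ hZ0
  have hin := H.norm_initial_le h
  have hs := supNormOn_nonneg U₀ (-D) 0
  have hB := H.residual_nonneg
  have hcδ : 0 ≤ c * δ := mul_nonneg (zero_le_one.trans H.one_le) H.error_pos.le
  have hγB := H.gain_disturbance.nonneg hB
  have herr := g.error_le
  have hU₀ : ∀ θ ∈ Ico (-D) 0, ‖U θ‖ ≤ ‖X₀‖ + supNormOn U₀ (-D) 0 := fun θ hθ => by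
    rw [h.init_input θ hθ]
    linarith [norm_le_supNormOn H.preset (Ico_subset_Icc_self hθ), norm_nonneg X₀]
  have hr : 0 ≤ ‖X₀‖ + supNormOn U₀ (-D) 0 := by positivity
  simp only [transientGain, residualGain]
  generalize ‖X₀‖ + supNormOn U₀ (-D) 0 = r at *
  have hσr := H.gain_reach.nonneg hr
  set b := β (σ r) (max (t - D) 0) with hbdef
  have hb0 : 0 ≤ b := hβ.nonneg hσr (le_max_right _ _)
  have hρb := H.gain_feedback.nonneg (show 0 ≤ 2 * b by positivity)
  have he0 := Real.exp_pos (D - t)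
  have hρ1 := H.gain_feedback.mono (show 0 ≤ 2 * γ (Cκ * (c * δ)) by positivity)
    (show 2 * γ (Cκ * (c * δ)) ≤ 2 * (γ (Cκ * (c * δ)) + 3 * (c * δ)) by linarith)
  have hρ0 := H.gain_feedback.nonneg (show 0 ≤ 2 * γ (Cκ * (c * δ)) by positivity)
  have hX : ‖X t‖ ≤ b + γ (Cκ * (c * δ)) + Real.exp (D - t) * σ r := by
    rcases le_total D t with hDt | hDt
    · have := hb (t - D) ⟨by linarith, by linarith [ht.2]⟩
      rw [sub_add_cancel] at this
      rw [hbdef, max_eq_left (by linarith)]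
      have := mul_nonneg he0.le hσr
      linarith
    · have h1 := hin t ⟨ht.1, hDt⟩
      have h2 : σ r ≤ Real.exp (D - t) * σ r :=
        le_mul_of_one_le_left hσr (Real.one_le_exp (by linarith))
      linarith
  have hU : ‖U θ‖ ≤ ρ (2 * b) + Real.exp (D - t) * r + ρ (2 * γ (Cκ * (c * δ))) + Cκ * (c * δ) := by
    rcases le_or_gt 0 θ with hθ0 | hθ0
    · have h1 := herr θ ⟨hθ0, hθN⟩
      have h2 := H.feedback_le (X (θ + D))
      have h3 := hb θ ⟨hθ0, hθN.le⟩
      have h4 : β (σ r) θ ≤ b :=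
        hβ.anti_right hσr (le_max_right _ _) (max_le hθ.1 hθ0)
      have h5 := H.gain_feedback.mono (norm_nonneg _) (h3.trans (add_le_add_left h4 _))
      have h6 := H.gain_feedback.map_add_le hb0 hγB
      have h7 := norm_sub_norm_le (U θ) (κ (X (θ + D)))
      have := mul_nonneg he0.le hr
      linarith
    -- A preset input is still in the window only if t ≤ θ + D < D, and then the exponential weight
    -- is at least 1.
    · have h1 := hU₀ θ ⟨by linarith [hθ.1, ht.1], hθ0⟩
      have h2 : r ≤ Real.exp (D - t) * r :=
        le_mul_of_one_le_left hr (Real.one_le_exp (by linarith [hθ.1]))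
      linarith
  have := H.error_pos
  nlinarith

/-- At each sampling time, the closed loop has visited data at which the prediction law is
accurate, and the nominal trajectory stays inside the ball of radius `R`. -/
theorem stage [ProperSpace E] [ProperSpace F] [BorelSpace F]
    (H : SampledLoop f κ D β γ σ ρ R Cκ c δ S K law T X₀ U₀)
    (h : ExtendedLoop f κ D T law X₀ U₀ X U Zhat N)
    (g : TracksFeedback κ D T (Cκ * (c * δ)) X U N) :
    (X (T N), inputHistory D U (T N)) ∈ K ∧
    IsPredictor f D (X (T N)) (inputHistory D U (T N)) (fun θ => X (T N + θ + D)) ∧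
    ∃ (Z : ℝ → E) (ζ : ℝ), Z 0 = X (T N + D) ∧ SolvesOn (fun _ z => f z (κ z)) Z 0 (Ici 0) ∧
      (∀ s, 0 ≤ s → ‖Z s‖ ≤ ζ) ∧ ζ + 3 * (c * δ) ≤ R ∧ ρ (ζ + 3 * (c * δ)) ≤ R := by
  have hN := H.sampling.nonneg N
  have hD := H.D_pos
  have hs := supNormOn_nonneg U₀ (-D) 0
  have hr : 0 ≤ ‖X₀‖ + supNormOn U₀ (-D) 0 := by positivity
  refine ⟨?_, ?_, ?_⟩
  · refine H.covers X U Zhat N h.toClosedLoopUpTo fun θ hθ => ?_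
    have h1 := H.norm_add_norm_le h g (t := T N) (θ := T N + θ) ⟨hN, le_rfl⟩
      ⟨by linarith [hθ.1], by linarith [hθ.2]⟩ (by linarith [hθ.2])
    have h2 := transientGain_anti (D := D) H.classKL H.gain_reach H.gain_feedback hr hN
    linarith [H.small]
  -- The plant trajectory is itself a predictor. As the approximation hypotheses concern every
  -- predictor, uniqueness of solutions is not needed.
  · refine ⟨by simp, ?_⟩
    have h1 := (h.solvesOn_shift (a := T N - D) (J := Icc (T N - D) (T N))
      ⟨by linarith, by linarith⟩ (Icc_subset_Icc_left (by linarith))).shift (J := Icc (-D) 0) (T N)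
      fun t ht => ⟨by linarith [ht.1], by linarith [ht.2]⟩
    rw [show T N - D - T N = -D by ring] at h1
    refine h1.congr ordConnected_Icc ⟨le_rfl, by linarith⟩
      (fun θ _ => by simp only [add_comm θ]) ?_
    filter_upwards [ae_ne 0] with θ hθ0 hθ
    have hmem : θ ∈ Ico (-D) 0 := ⟨hθ.1, lt_of_le_of_ne hθ.2 hθ0⟩
    rw [inputHistory, indicator_of_mem hmem, add_comm θ]
  · obtain ⟨Z, hZ0, hZ⟩ := H.flow (X (T N + D))
    obtain ⟨-, hb⟩ := H.norm_le_of_tracksFeedback h g hZ hZ0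
    have hsmall := H.small
    -- Here ζ = β(σ r, 0) + γ(Cκ c δ). The terms 3cδ and ρ(2(γ + 3cδ)) of `residualGain` are there
    -- to make both inequalities for ζ follow from `small`.
    refine ⟨Z, _, hZ0, hZ, hb, ?_⟩
    generalize ‖X₀‖ + supNormOn U₀ (-D) 0 = r at *
    have hσr := H.gain_reach.nonneg hr
    have hb0 : 0 ≤ β (σ r) 0 := H.classKL.nonneg hσr le_rfl
    have hB := H.residual_nonneg
    have hcδ : 0 ≤ c * δ := mul_nonneg (zero_le_one.trans H.one_le) H.error_pos.le
    have hγB := H.gain_disturbance.nonneg hB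
    simp only [transientGain, residualGain] at hsmall
    rw [max_eq_right (by linarith : 0 - D ≤ 0)] at hsmall
    have hρb := H.gain_feedback.nonneg (show 0 ≤ 2 * β (σ r) 0 by positivity)
    have hρ0 := H.gain_feedback.nonneg
      (show 0 ≤ 2 * (γ (Cκ * (c * δ)) + 3 * (c * δ)) by positivity)
    have he := mul_nonneg (Real.exp_pos (D - 0)).le (show 0 ≤ σ r + r by positivity)
    have hδ := H.error_pos
    refine ⟨by linarith, ?_⟩
    have := H.gain_feedback.map_add_le hb0
      (show 0 ≤ γ (Cκ * (c * δ)) + 3 * (c * δ) by positivity)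
    rw [add_assoc]
    linarith

/-- Induction on the sampling index: smallness of the error before T N gives, through `stage`, all
that the admissible law needs to bound the error on the next interval. The bound does not
deteriorate, since the stability estimate is applied from time D afresh at each stage. -/
theorem tracksFeedback [ProperSpace E] [ProperSpace F] [BorelSpace F]
    (H : SampledLoop f κ D β γ σ ρ R Cκ c δ S K law T X₀ U₀)
    (h : ExtendedLoop f κ D T law X₀ U₀ X U Zhat N) :
    TracksFeedback κ D T (Cκ * (c * δ)) X U N := by
  induction N with
  | zero => exact ⟨by simp, by simp [H.sampling.1]⟩
  | succ N ih =>
    have hmono := H.sampling.2.1.monotone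
    have h' := h.mono hmono (Nat.le_succ N)
    have g := ih h'
    have hN := H.sampling.nonneg N
    have hD := H.D_pos
    have hτ : 0 < T (N + 1) - T N := sub_pos.2 (H.sampling.2.1 (Nat.lt_succ_self N))
    obtain ⟨hK, hP, Z, ζ, hZ0, hZ, hζ, hR, hρR⟩ := H.stage h' g
    obtain ⟨hzc, hstep⟩ := H.admissible.step _ _ _ _ _ Z ζ hK (H.sampling_mem N) hτ hP
      (h.prediction N (Nat.lt_succ_self N)) hZ (by simpa using hZ0) hζ hR hρR
    have hctrl := h.control N (Nat.lt_succ_self N)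
    have hU : ∀ t ∈ Ico (T N) (T (N + 1)), U t = κ (Zhat (T N + (t - T N))) := fun t ht => by
      rw [hctrl t ht, add_sub_cancel]
    have hmem : ∀ t ∈ Ico (T N) (T (N + 1)), t - T N ∈ Ico 0 (T (N + 1) - T N) := fun t ht =>
      ⟨by linarith [ht.1], by linarith [ht.2]⟩
    have hy : SolvesOn (fun s y => f y (κ (Zhat (T N + s)))) (fun s => X (T N + s + D)) 0
        (Icc 0 (T (N + 1) - T N)) := by
      have h1 := (h.solvesOn_shift (a := T N) (J := Icc (T N) (T (N + 1)))
        ⟨by linarith, by linarith⟩ (Icc_subset_Icc_left (by linarith))).shift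
        (J := Icc 0 (T (N + 1) - T N)) (T N) fun t ht => ⟨by linarith [ht.1], by linarith [ht.2]⟩
      rw [sub_self] at h1
      refine h1.congr ordConnected_Icc ⟨le_rfl, hτ.le⟩ (fun s _ => by simp only [add_comm s]) ?_
      filter_upwards [ae_ne (T (N + 1) - T N)] with s hsne hs
      have hlt := lt_of_le_of_ne hs.2 hsne
      rw [hctrl (s + T N) ⟨by linarith [hs.1], by linarith⟩, add_comm s]
    have herr := hstep _ (by simp) hy
    refine ⟨fun i hi => ?_, fun t ht => ?_⟩
    · rcases Nat.lt_succ_iff_lt_or_eq.1 hi with hi | rfl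
      · exact g.continuousOn i hi
      · exact (H.continuous_feedback.comp_continuousOn
          (hzc.comp (g := fun s => Zhat (T i + s)) (f := fun t => t - T i)
            (by fun_prop) hmem)).congr hU
    · rcases lt_or_ge t (T N) with htN | htN
      · exact g.error_le t ⟨ht.1, htN⟩
      · have ht' : t ∈ Ico (T N) (T (N + 1)) := ⟨htN, ht.2⟩
        have := herr _ (hmem t ht')
        rw [← hU t ht'] at this
        simpa using this

theorem extendedLoop (H : SampledLoop f κ D β γ σ ρ R Cκ c δ S K law T X₀ U₀)
    (h : ∀ N, ClosedLoopUpTo f κ D T law X₀ U₀ X U Zhat N) (N : ℕ) :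
    ExtendedLoop f κ D T law X₀ U₀ X U Zhat N := by
  obtain ⟨M, hM⟩ := (H.sampling.2.2.eventually_gt_atTop (T N + D)).exists
  exact ⟨h N, (h M).plant.mono (Icc_subset_Icc_right hM.le)⟩

theorem practical_bound [ProperSpace E] [ProperSpace F] [BorelSpace F]
    (H : SampledLoop f κ D β γ σ ρ R Cκ c δ S K law T X₀ U₀)
    (h : ∀ N, ClosedLoopUpTo f κ D T law X₀ U₀ X U Zhat N) {t : ℝ} (ht : 0 ≤ t) :
    BddAbove ((fun θ => ‖U θ‖) '' Icc (t - D) t) ∧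
      ‖X t‖ + supNormOn U (t - D) t ≤
        transientGain β σ ρ D (‖X₀‖ + supNormOn U₀ (-D) 0) t + residualGain γ ρ Cκ c δ := by
  -- T N lies strictly beyond t, since U(t) itself enters the supremum.
  obtain ⟨N, hN⟩ := (H.sampling.2.2.eventually_gt_atTop t).exists
  have hE := H.extendedLoop h N
  have hb : ∀ y ∈ (fun θ => ‖U θ‖) '' Icc (t - D) t, y ≤
      transientGain β σ ρ D (‖X₀‖ + supNormOn U₀ (-D) 0) t + residualGain γ ρ Cκ c δ - ‖X t‖ := by
    rintro _ ⟨θ, hθ, rfl⟩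
    have := H.norm_add_norm_le hE (H.tracksFeedback hE) ⟨ht, hN.le⟩ hθ (hθ.2.trans_lt hN)
    simp only
    linarith
  refine ⟨⟨_, hb⟩, ?_⟩
  have := csSup_le ((nonempty_Icc.2 (by linarith [H.D_pos])).image _) hb
  rw [supNormOn]
  linarith

end SampledLoop

end

end Estimates

/-! ### Construction of a global closed-loop solution. -/

theorem exists_seq_of_step {α : Type*} {P : ℕ → α → Prop} {r : ℕ → α → α → Prop}
    (h0 : ∃ a, P 0 a) (hs : ∀ n a, P n a → ∃ b, P (n + 1) b ∧ r n a b) :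
    ∃ s : ℕ → α, ∀ n, P n (s n) ∧ r n (s n) (s (n + 1)) := by
  obtain ⟨a, ha⟩ := h0
  choose! next hnext using hs
  let s : ℕ → α := fun n => Nat.rec a (fun n a => next n a) n
  have hP : ∀ n, P n (s n) := fun n => by
    induction n with
    | zero => exact ha
    | succ n ih => exact (hnext n _ ih).1
  exact ⟨s, fun n => ⟨hP n, (hnext n _ (hP n)).2⟩⟩

section Existence

variable {E F : Type*} [NormedAddCommGroup E] [NormedSpace ℝ E] [NormedAddCommGroup F]
  {f : E → F → E} {κ : E → F} {D : ℝ} {T : ℕ → ℝ}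
  {law : PredictionLaw E F} {X₀ : E} {U₀ : ℝ → F} {X : ℝ → E} {U : ℝ → F}
  {Zhat : ℝ → E} {N : ℕ} [MeasurableSpace F] [BorelSpace F] [ProperSpace F]
  [MeasurableSpace E] [BorelSpace E] [ProperSpace E]
  {β : ℝ → ℝ → ℝ} {γ σ ρ : ℝ → ℝ} {R Cκ c δ : ℝ} {S : Set ℝ} {K : Set (E × (ℝ → F))}

namespace SampledLoop

theorem exists_extendedLoop_zero (H : SampledLoop f κ D β γ σ ρ R Cκ c δ S K law T X₀ U₀) :
    ∃ X U Zhat, ExtendedLoop f κ D T law X₀ U₀ X U Zhat 0 := by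
  have hmem : ∀ t ∈ Ico 0 D, t - D ∈ Ico (-D) 0 := fun s hs =>
    ⟨by linarith [hs.1], by linarith [hs.2]⟩
  obtain ⟨X, hX0, hX⟩ := exists_solvesOn_plant H.lip H.complete H.D_pos.le
    (v := fun t => U₀ (t - D)) ((H.preset.mono Ico_subset_Icc_self).comp (by fun_prop) hmem)
    (fun t ht => norm_le_supNormOn H.preset (Ico_subset_Icc_self (hmem t ht))) X₀
  refine ⟨X, U₀, fun _ => 0, ⟨⟨hX0, fun _ _ => rfl, ?_, by simp, by simp⟩, ?_⟩⟩
  · rw [H.sampling.1]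
    exact hX.mono (Icc_subset_Icc_right H.D_pos.le)
  · rwa [H.sampling.1, zero_add]

theorem exists_extendedLoop_succ (H : SampledLoop f κ D β γ σ ρ R Cκ c δ S K law T X₀ U₀)
    (h : ExtendedLoop f κ D T law X₀ U₀ X U Zhat N) :
    ∃ X' U' Zhat', ExtendedLoop f κ D T law X₀ U₀ X' U' Zhat' (N + 1) ∧
      EqOn X X' (Iic (T N)) ∧ EqOn U U' (Iio (T N)) ∧ EqOn Zhat Zhat' (Iio (T N)) := by
  classical
  have hN := H.sampling.nonneg N
  have hD := H.D_pos
  have hlt : T N < T (N + 1) := H.sampling.2.1 (Nat.lt_succ_self N)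
  have hτ : 0 < T (N + 1) - T N := sub_pos.2 hlt
  -- Existence already relies on the a priori estimate: it places the data in K, and only there is
  -- the law known to produce a continuous, bounded prediction.
  obtain ⟨hK, hP, -⟩ := H.stage h (H.tracksFeedback h)
  obtain ⟨z, hz, hzc, M, hzM⟩ := H.admissible.exists_prediction _ _ _ _ hK (H.sampling_mem N) hτ hP
  have hmem : ∀ t ∈ Ico (T N + D) (T (N + 1) + D), t - D - T N ∈ Ico 0 (T (N + 1) - T N) :=
    fun t ht => ⟨by linarith [ht.1], by linarith [ht.2]⟩
  obtain ⟨X₁, hX₁0, hX₁⟩ := exists_solvesOn_plant H.lip H.complete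
    (show T N + D ≤ T (N + 1) + D by linarith) (v := fun t => κ (z (t - D - T N))) (M := ρ M)
    (H.continuous_feedback.comp_continuousOn (hzc.comp (by fun_prop) hmem))
    (fun t ht => (H.feedback_le _).trans
      (H.gain_feedback.mono (norm_nonneg _) (hzM _ (hmem t ht)))) (X (T N + D))
  set X' : ℝ → E := fun t => if t ≤ T N + D then X t else X₁ t with hX'
  set U' : ℝ → F := fun t => if t < T N then U t else κ (z (t - T N)) with hU'
  set Z' : ℝ → E := fun t => if t < T N then Zhat t else z (t - T N) with hZ'
  have eX : EqOn X X' (Iic (T N + D)) := fun t ht => (if_pos ht).symm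
  have eU : EqOn U U' (Iio (T N)) := fun t ht => (if_pos ht).symm
  have eZ : EqOn Zhat Z' (Iio (T N)) := fun t ht => (if_pos ht).symm
  have eX₁ : EqOn X₁ X' (Icc (T N + D) (T (N + 1) + D)) := fun t ht => by
    rcases ht.1.eq_or_lt with rfl | hlt
    · rw [hX₁0]; exact eX self_mem_Iic
    · exact (if_neg (not_le.2 hlt)).symm
  have eU₁ : ∀ t, T N ≤ t → U' t = κ (z (t - T N)) := fun t ht => if_neg (not_lt.2 ht)
  have eZ₁ : ∀ t, T N ≤ t → Z' t = z (t - T N) := fun t ht => if_neg (not_lt.2 ht)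
  have eX' : EqOn X X' (Iic (T N)) := eX.mono (Iic_subset_Iic.2 (by linarith))
  have hC := h.toClosedLoopUpTo.congr H.sampling hD H.admissible.congr eX' eU eZ
  have h1 : SolvesOn (fun t x => f x (U' (t - D))) X' 0 (Icc 0 (T N + D)) := by
    refine h.plant_extended.congr ordConnected_Icc ⟨le_rfl, by linarith⟩ (fun t ht => eX ht.2) ?_
    filter_upwards [ae_ne (T N + D)] with s hs hsI
    have hs' := lt_of_le_of_ne hsI.2 hs
    rw [eU (show s - D < T N by linarith)]
  have h2 : SolvesOn (fun t x => f x (U' (t - D))) X' (T N + D)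
      (Icc (T N + D) (T (N + 1) + D)) := by
    refine hX₁.congr ordConnected_Icc ⟨le_rfl, by linarith⟩ eX₁ (Eventually.of_forall ?_)
    intro s hs
    rw [eU₁ (s - D) (by linarith [hs.1])]
  have h3 := h1.union h2 ⟨by linarith, le_rfl⟩ isClosed_Icc isClosed_Icc
  rw [Icc_union_Icc_eq_Icc (by linarith) (by linarith)] at h3
  refine ⟨X', U', Z', ⟨⟨hC.init_state, hC.init_input, ?_, ?_, ?_⟩, h3⟩, eX', eU, eZ⟩
  · exact h3.mono (Icc_subset_Icc_right (by linarith))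
  · intro i hi
    rcases Nat.lt_succ_iff_lt_or_eq.1 hi with hi | rfl
    · exact hC.prediction i hi
    · rw [← eX' self_mem_Iic, ← inputHistory_congr eU]
      refine H.admissible.congr _ _ _ _ _ hτ (fun s hs => ?_) hz
      simp only [eZ₁ (T i + s) (by linarith [hs.1]), add_sub_cancel_left]
  · intro i hi
    rcases Nat.lt_succ_iff_lt_or_eq.1 hi with hi | rfl
    · exact hC.control i hi
    · intro t ht
      rw [eU₁ t ht.1, eZ₁ t ht.1]

theorem exists_closedLoop (H : SampledLoop f κ D β γ σ ρ R Cκ c δ S K law T X₀ U₀) :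
    ∃ X U Zhat, ∀ N, ClosedLoopUpTo f κ D T law X₀ U₀ X U Zhat N := by
  obtain ⟨s, hs⟩ := exists_seq_of_step (α := (ℝ → E) × (ℝ → F) × (ℝ → E))
    (P := fun N p => ExtendedLoop f κ D T law X₀ U₀ p.1 p.2.1 p.2.2 N)
    (r := fun N p q => EqOn p.1 q.1 (Iic (T N)) ∧ EqOn p.2.1 q.2.1 (Iio (T N)) ∧
      EqOn p.2.2 q.2.2 (Iio (T N)))
    (by obtain ⟨X, U, Z, h⟩ := H.exists_extendedLoop_zero; exact ⟨(X, U, Z), h⟩)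
    (fun N p hp => by
      obtain ⟨X, U, Z, h, h'⟩ := H.exists_extendedLoop_succ hp
      exact ⟨(X, U, Z), h, h'⟩)
  have hmono := H.sampling.2.1.monotone
  have agree : ∀ M N, M ≤ N → EqOn (s M).1 (s N).1 (Iic (T M)) ∧
      EqOn (s M).2.1 (s N).2.1 (Iio (T M)) ∧ EqOn (s M).2.2 (s N).2.2 (Iio (T M)) := by
    intro M N hMN
    induction N, hMN using Nat.le_induction with
    | base => exact ⟨eqOn_refl _ _, eqOn_refl _ _, eqOn_refl _ _⟩
    | succ N hMN ih =>
      obtain ⟨-, h1, h2, h3⟩ := hs N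
      have hT := hmono hMN
      exact ⟨ih.1.trans (h1.mono (Iic_subset_Iic.2 hT)),
        ih.2.1.trans (h2.mono (Iio_subset_Iio hT)), ih.2.2.trans (h3.mono (Iio_subset_Iio hT))⟩
  have hex : ∀ t, ∃ k, t < T k := fun t => (H.sampling.2.2.eventually_gt_atTop t).exists
  choose k hk using hex
  -- The value at t is read from a stage with t < T (k t), beyond which later stages no longer
  -- change it.
  refine ⟨fun t => (s (k t)).1 t, fun t => (s (k t)).2.1 t, fun t => (s (k t)).2.2 t, fun N => ?_⟩
  refine (hs N).1.toClosedLoopUpTo.congr H.sampling H.D_pos H.admissible.congr ?_ ?_ ?_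
  · intro t ht
    rcases le_total N (k t) with h | h
    · exact (agree _ _ h).1 ht
    · exact ((agree _ _ h).1 (hk t).le).symm
  · intro t ht
    rcases le_total N (k t) with h | h
    · exact (agree _ _ h).2.1 ht
    · exact ((agree _ _ h).2.1 (hk t)).symm
  · intro t ht
    rcases le_total N (k t) with h | h
    · exact (agree _ _ h).2.2 ht
    · exact ((agree _ _ h).2.2 (hk t)).symm

end SampledLoop

end Existence

/-! ### Comparison properties of the gains, and conclusion. -/

section Gains

variable {β : ℝ → ℝ → ℝ} {γ σ ρ : ℝ → ℝ} {D Cκ c : ℝ}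

theorem classKInf_transientGain (hβ : ClassKL β) (hσ : MonoGain σ) (hρ : MonoGain ρ) (t : ℝ) :
    ClassKInf (fun r => transientGain β σ ρ D r t) := by
  have h1 : MonoGain (fun r => β r (max (t - D) 0)) := (hβ.1 _ (le_max_right _ _)).monoGain
  have h2 := h1.comp hσ
  have h3 := hρ.comp (h2.const_mul zero_le_two)
  have h4 := hσ.const_mul (Real.exp_pos (D - t)).le
  convert ((h2.add h3).add h4).classKInf_add_linear (Real.exp_pos (D - t)) using 2 with r
  simp only [transientGain]
  ring

theorem classKL_transientGain (hβ : ClassKL β) (hσ : MonoGain σ) (hρ : MonoGain ρ) :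
    ClassKL (transientGain β σ ρ D) := by
  refine ⟨fun t _ => (classKInf_transientGain hβ hσ hρ t).1, fun r hr => ⟨?_, ?_⟩⟩
  · exact fun t _ t' _ htt => transientGain_anti hβ hσ hρ hr htt
  · have hσr := hσ.nonneg hr
    have hb : Tendsto (fun t => β (σ r) (max (t - D) 0)) atTop (𝓝 0) :=
      (hβ.2 _ hσr).2.comp
        (tendsto_atTop_mono (fun t => le_max_left (t - D) 0)
          (tendsto_atTop_add_const_right _ _ tendsto_id))
    have hρb : Tendsto (fun t => ρ (2 * β (σ r) (max (t - D) 0))) atTop (𝓝 0) := by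
      have hc : Tendsto ρ (𝓝[Ici 0] 0) (𝓝 0) := by
        simpa [ContinuousWithinAt, hρ.map_zero] using hρ.continuousOn 0 self_mem_Ici
      refine hc.comp (tendsto_nhdsWithin_iff.2 ⟨by simpa using hb.const_mul 2, ?_⟩)
      exact Eventually.of_forall fun t =>
        mul_nonneg zero_le_two (hβ.nonneg hσr (le_max_right _ _))
    have he : Tendsto (fun t => Real.exp (D - t)) atTop (𝓝 0) :=
      Real.tendsto_exp_atBot.comp (tendsto_atBot_add_const_left _ D tendsto_neg_atTop_atBot)
    have hsum := (hb.add hρb).add (he.mul_const (σ r + r))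
    rw [add_zero, zero_mul, add_zero] at hsum
    exact hsum

theorem classKInf_residualGain (hγ : MonoGain γ) (hρ : MonoGain ρ) (hCκ : 0 ≤ Cκ) (hc : 0 ≤ c) :
    ClassKInf (residualGain γ ρ Cκ c) := by
  have h0 := (MonoGain.linear hc).const_mul hCκ
  have h1 := hγ.comp h0
  have h2 := (MonoGain.linear hc).const_mul (zero_le_three (α := ℝ))
  have h3 := hρ.comp ((h1.add h2).const_mul zero_le_two)
  convert (((h1.add h3).add h0).add h2).classKInf_add_linear one_pos using 1
  ext1 s
  simp only [residualGain]
  ring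

end Gains

theorem practicalEstimate_of_admissibleLaw {E F : Type*} [NormedAddCommGroup E] [NormedSpace ℝ E]
    [NormedAddCommGroup F] [MeasurableSpace F] [BorelSpace F] [ProperSpace F]
    [MeasurableSpace E] [BorelSpace E] [ProperSpace E] {f : E → F → E} {κ : E → F} {D : ℝ}
    {T : ℕ → ℝ} {law : PredictionLaw E F} {β : ℝ → ℝ → ℝ} {γ σ ρ : ℝ → ℝ} {R Cκ c ε : ℝ}
    {δ : ℝ → ℝ} {S : Set ℝ} {K : Set (E × (ℝ → F))} (H : PlantGains f κ D β γ σ ρ)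
    (hCκ : 0 ≤ Cκ) (hc : 1 ≤ c) (hR : 0 < R) (hδ : ClassKInf δ) (hε : 0 < ε)
    (hεR : ε < epsStar (residualGain γ ρ Cκ c) δ R) (hT : IsSamplingSequence T)
    (hTS : ∀ i, T (i + 1) - T i ∈ S) (hlaw : AdmissibleLaw f κ ρ D R Cκ c (δ ε) S K law) :
    PracticalEstimate f κ D T law K (transientGain β σ ρ D) (residualGain γ ρ Cκ c) δ R ε := by
  intro X₀ U₀ hU₀ hr hcov
  have hα := classKInf_residualGain (c := c) H.gain_disturbance H.gain_feedback hCκ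
    (zero_le_one.trans hc)
  have hδε : 0 < δ ε := by
    have := (hδ.lt_iff le_rfl hε.le).2 hε
    rwa [hδ.1.2.2] at this
  have L : SampledLoop f κ D β γ σ ρ R Cκ c (δ ε) S K law T X₀ U₀ :=
    { H with
      admissible := hlaw
      sampling := hT
      sampling_mem := hTS
      lip_nonneg := hCκ
      one_le := hc
      error_pos := hδε
      preset := hU₀
      covers := hcov
      small := add_le_of_le_omegaRadius (β := transientGain β σ ρ D)
        (classKInf_transientGain H.classKL H.gain_reach H.gain_feedback 0)
        (apply_lt_of_lt_epsStar hα hδ hR hε.le hεR)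
        (add_nonneg (norm_nonneg _) (supNormOn_nonneg _ _ _)) hr }
  exact ⟨L.exists_closedLoop, fun X U Zhat h t ht => L.practical_bound h ht⟩

theorem theorem1 {n m : ℕ}
    (f : EuclideanSpace ℝ (Fin n) → EuclideanSpace ℝ (Fin m) → EuclideanSpace ℝ (Fin n))
    (κ : EuclideanSpace ℝ (Fin n) → EuclideanSpace ℝ (Fin m))
    (D : ℝ) (hD : 0 < D)
    (hf : LipschitzOnCompacts f)
    (hfc : StronglyForwardComplete f)
    (hκ : ContDiff ℝ 1 κ) (hκ0 : κ 0 = 0)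
    (hgas : GloballyAsymptoticallyStable (fun x => f x (κ x)))
    (hiss : InputToStateStable (fun x w => f x (κ x + w))) :
    ∃ β : ℝ → ℝ → ℝ, ClassKL β ∧ ClassKInf (fun r => β r 0) ∧
      ∀ R : ℝ, 0 < R → ∀ Cf Cκ : ℝ, 0 ≤ Cf → 0 ≤ Cκ →
        LipConstOn₂ f (Metric.closedBall 0 R) (Metric.closedBall 0 R) Cf →
        LipConstOn κ (Metric.closedBall 0 R) Cκ →
        -- uniform sampling, approximate sampling-horizon prediction operator
        (∀ h : ℝ, 0 < h → ∃ α : ℝ → ℝ, ClassKInf α ∧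
          0 < epsStar α (fun ε => ε) R ∧
          ∀ ε : ℝ, 0 < ε → ε < epsStar α (fun ε => ε) R →
          ∀ T : ℕ → ℝ, IsSamplingSequence T → (∀ i, T (i + 1) - T i = h) →
          ∀ K Mhat, ApproxPredictionOperator f κ D h ε K Mhat →
            PracticalEstimate f κ D T (operatorLaw Mhat) K β α (fun ε => ε) R ε) ∧
        -- bounded sampling, approximate predictor propagated by the closed-loop flow
        (∃ α : ℝ → ℝ, ClassKInf α ∧
          ∀ h : ℝ, 0 < h →
          0 < epsStar α (fun ε => ε * Real.exp (Cf * (1 + Cκ) * h)) R ∧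
          ∀ ε : ℝ, 0 < ε → ε < epsStar α (fun ε => ε * Real.exp (Cf * (1 + Cκ) * h)) R →
          ∀ T : ℕ → ℝ, IsSamplingSequence T → (∀ i, T (i + 1) - T i ≤ h) →
          ∀ K Phat, ApproxPredictor f D ε K Phat →
            PracticalEstimate f κ D T (predictorLaw f κ Phat) K β α
              (fun ε => ε * Real.exp (Cf * (1 + Cκ) * h)) R ε) := by
  obtain ⟨β, γ, hβ, hγ, hiss⟩ := hiss
  obtain ⟨ρ, hρ, hκρ⟩ := exists_monoGain_norm_le hκ.continuous hκ0
  obtain ⟨σ, hσ, hreach⟩ := hfc.exists_reach_gain D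
  have H : PlantGains f κ D β γ σ ρ :=
    { D_pos := hD
      lip := hf
      complete := hfc
      continuous_feedback := hκ.continuous
      flow := hgas.1
      classKL := hβ
      gain_disturbance := hγ.monoGain
      iss := fun w B X hw hB hwB hX t ht =>
        (hiss (X 0) w hw fun _ => ⟨B, Eventually.of_forall hwB⟩).2 X rfl hX t ht B hB
          (Eventually.of_forall hwB)
      gain_reach := hσ
      reach := hreach
      gain_feedback := hρ
      feedback_le := hκρ }
  refine ⟨transientGain β σ ρ D, classKL_transientGain hβ hσ hρ,
    classKInf_transientGain hβ hσ hρ 0, ?_⟩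
  intro R hR Cf Cκ hCf hCκ hlf hlκ
  refine ⟨fun h hh => ?_, ?_⟩
  · have hc : 1 ≤ 1 + Cκ * Real.exp (Cf * h) := le_add_of_nonneg_right (by positivity)
    have hα := classKInf_residualGain hγ.monoGain hρ hCκ (zero_le_one.trans hc)
    have hδ : ClassKInf (fun ε : ℝ => ε) :=
      ⟨⟨continuousOn_id, fun _ _ _ _ h => h, rfl⟩, tendsto_id⟩
    refine ⟨_, hα, epsStar_pos hα hδ hR, fun ε hε hεR T hT hTh K Mhat hM => ?_⟩
    exact practicalEstimate_of_admissibleLaw H hCκ hc hR hδ hε hεR hT hTh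
      (admissibleLaw_operatorLaw hf.continuous hκ.continuous hgas.1 hρ hκρ hCf hCκ hlf hlκ hε hM)
  -- With c = 1 the residual gain is fixed before h; the horizon enters only through δ.
  · have hα := classKInf_residualGain hγ.monoGain hρ hCκ zero_le_one
    refine ⟨_, hα, fun h hh => ?_⟩
    have hδ : ClassKInf (fun ε : ℝ => ε * Real.exp (Cf * (1 + Cκ) * h)) := by
      have he := Real.exp_pos (Cf * (1 + Cκ) * h)
      exact ⟨⟨by fun_prop, fun _ _ _ _ h => mul_lt_mul_of_pos_right h he, zero_mul _⟩,
        tendsto_id.atTop_mul_const he⟩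
    refine ⟨epsStar_pos hα hδ hR, fun ε hε hεR T hT hTh K Phat hP => ?_⟩
    exact practicalEstimate_of_admissibleLaw H hCκ le_rfl hR hδ hε hεR hT hTh
      (admissibleLaw_predictorLaw hf.continuous hκ.continuous hD hgas.1 hρ hκρ hCf hCκ hlf hlκ
        hε hP)
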